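/- Let $\sigma\in\mathbb R$, $\sigma\neq 0$, let $P_n$ be the Legendre polynomials and $U_n$ the Chebyshev polynomials of the second kind, and let $$\mathcal Q^{1/2}u(x)=\frac1{\sqrt\pi}\int_{-1}^x\frac{u(t)}{\sqrt{x-t}}\,dt ,\qquad x\in[-1,1].$$ Let $Q_{\mathbf P}$ be the infinite upper bidiagonal matrix with $(Q_{\mathbf P})_{n,n}=\frac{2}{\sqrt\pi(2n+1)}$ and $(Q_{\mathbf P})_{n-1,n}=-\frac{2}{\sqrt\pi(2n+1)}$, and $Q_{\mathbf U}$ the infinite lower bidiagonal matrix with $(Q_{\mathbf U})_{n,n}=(Q_{\mathbf U})_{n+1,n}=\frac{\sqrt\pi}{2}$ (indices start at $0$); they represent $\mathcal Q^{1/2}$ from the basis $(P_n)$ to the basis $(\sqrt{1+x}\,U_n)$ and vice versa. For real sequences $\underline e,\underline f$ consider the system $$\begin{pmatrix}\sigma I & Q_{\mathbf U}\\ Q_{\mathbf P}&\sigma I\end{pmatrix}\begin{pmatrix}\underline a\\ \underline b\end{pmatrix}=\begin{pmatrix}\underline e\\ \underline f\end{pmatrix}\qquad(1)$$ and its $2N\times2N$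 finite section, obtained by replacing each block by its leading $N\times N$ part and $\underline e,\underline f$ by their first $N$ entries. When the latter is uniquely solvable, its solution, extended by zeros, is denoted by $(\underline a_N,\underline b_N)$, and $$u_N(x)=\sum_{k<N}(\underline a_N)_kP_k(x)+\sqrt{1+x}\sum_{k<N}(\underline b_N)_kU_k(x).$$ For $\lambda\in\mathbb R$ let $\ell^2_\lambda$ be the space of real sequences with $\|\underline v\|_{\ell^2_\lambda}^2=\sum_{k\ge0}(k+1)^{2\lambda}v_k^2<\infty$. Then: 0. For all sufficiently large $N$ (depending only on $\sigma$) the finite section matrix is invertible. 1. For every $\lambda\in\mathbb R$: if $\underline e,\underline f\in\ell^2_\lambda$, then (1) has a unique solution $(\underline a,\underline b)\in\ell^2_\lambda\times\ell^2_\lambda$, and $\|\underline a_N-\underline a\|_{\ell^2_\lambda}\to0$ and $\|\underline b_N-\underline b\|_{\ell^2_\lambda}\to0$ as $N\to\infty$. 2. If $\underline e,\underline f\in\ell^2_\lambda$ for all $\lambda$, then the equation $$\sigma u(x)+\mathcal Q^{1/2}u(x)=\sum_{n\ge0}e_nP_n(x)+\sqrt{1+x}\sum_{n\ge0}f_nU_n(x)\quad\text{for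 a.e. }x\in[-1,1]\qquad(2)$$ has a unique solution $u\in L^2[-1,1]$, and for every $p>0$ there is a constant $C$ such that $\|u_N-u\|_{L^2[-1,1]}\le C N^{-p}$ for all sufficiently large $N$. 3. If $0<\rho<1$ and $|e_k|,|f_k|\le K\rho^k$ for all $k$ and some constant $K$, then (2) has a unique solution $u\in L^2[-1,1]$, and for every $r\in(\rho,1)$ there is a constant $C$ such that $\|u_N-u\|_{L^2[-1,1]}\le C r^N$ for all sufficiently large $N$. -/

import Mathlib

open Filter Topology MeasureTheory

noncomputable section

namespace HalfIntegral

/-- The ultraspherical polynomial `C_n^{(lam)}` evaluated at `x`, by the three-term recurrence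
`(n + 1) C_{n+1} = 2 (n + lam) x C_n - (n + 2 lam - 1) C_{n-1}`, `C_0 = 1`, `C_{-1} = 0`. -/
def ultraspherical (lam : ℝ) : ℕ → ℝ → ℝ
  | 0, _ => 1
  | 1, x => 2 * lam * x
  | n + 2, x =>
      (2 * ((n : ℝ) + 1 + lam) * x * ultraspherical lam (n + 1) x
        - ((n : ℝ) + 2 * lam) * ultraspherical lam n x) / ((n : ℝ) + 2)

/-- The Legendre polynomial `P_n = C_n^{(1/2)}`. -/
def legendreP (n : ℕ) (x : ℝ) : ℝ := ultraspherical (1 / 2) n x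

/-- The Chebyshev polynomial of the second kind `U_n = C_n^{(1)}`. -/
def chebyshevU (n : ℕ) (x : ℝ) : ℝ := (Polynomial.Chebyshev.U ℝ (n : ℤ)).eval x

/-- Lebesgue measure on `[-1, 1]`. -/
def volI : Measure ℝ := volume.restrict (Set.Icc (-1) 1)

/-- The left-sided half-integral `(1/√π) ∫_{-1}^x u(t) (x - t)^{-1/2} dt`. For `u ∈ L²[-1,1]` the
integrand is integrable for almost every `x ∈ [-1,1]`. -/
def halfInt (u : ℝ → ℝ) (x : ℝ) : ℝ :=
  (1 / √Real.pi) * ∫ t in (-1 : ℝ)..x, u t / √(x - t)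

/-- The upper bidiagonal matrix of the half-integral from the Legendre basis `P_n` to the weighted
Chebyshev basis `√(1+x) U_n`: column `n` has the entry `2/(√π (2n+1))` in row `n` and its negative
in row `n - 1`. -/
def QP : Matrix ℕ ℕ ℝ := fun k n =>
  if k = n then 2 / (√Real.pi * (2 * (n : ℝ) + 1))
  else if k + 1 = n then -(2 / (√Real.pi * (2 * (n : ℝ) + 1)))
  else 0

/-- The lower bidiagonal matrix of the half-integral from the weighted Chebyshev basis
`√(1+x) U_n` to the Legendre basis `P_n`: column `n` has the entry `√π/2` in rows `n` and `n+1`. -/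
def QU : Matrix ℕ ℕ ℝ := fun k n =>
  if k = n ∨ k = n + 1 then √Real.pi / 2 else 0

/-- The product of an infinite matrix and a sequence. It is only used for matrices whose rows have
finitely many nonzero entries, so that each of these sums is finite. -/
def matVec (A : Matrix ℕ ℕ ℝ) (v : ℕ → ℝ) (k : ℕ) : ℝ := ∑' n, A k n * v n

/-- `(a, b)` solves the infinite block system
`[[σ I, QU], [QP, σ I]] (a, b) = (e, f)`. -/
def SolvesSystem (σ : ℝ) (e f a b : ℕ → ℝ) : Prop :=
  (∀ k, σ * a k + matVec QU b k = e k) ∧ (∀ k, matVec QP a k + σ * b k = f k)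

/-- The `N × N` finite section `P_N A P_Nᵀ` of an infinite matrix. -/
def finSection (N : ℕ) (A : Matrix ℕ ℕ ℝ) : Matrix (Fin N) (Fin N) ℝ :=
  A.submatrix (fun i => (i : ℕ)) (fun i => (i : ℕ))

/-- The `2N × 2N` finite section of the block system. -/
def blockSection (σ : ℝ) (N : ℕ) : Matrix (Fin N ⊕ Fin N) (Fin N ⊕ Fin N) ℝ :=
  Matrix.fromBlocks (σ • (1 : Matrix (Fin N) (Fin N) ℝ)) (finSection N QU)
    (finSection N QP) (σ • (1 : Matrix (Fin N) (Fin N) ℝ))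

/-- The solution of the `2N × 2N` finite section (meaningful when the matrix is invertible). -/
def blockSol (σ : ℝ) (e f : ℕ → ℝ) (N : ℕ) : Fin N ⊕ Fin N → ℝ :=
  Matrix.mulVec (blockSection σ N)⁻¹ (Sum.elim (fun i => e i) (fun i => f i))

/-- The finite section coefficients `a_N`, extended by zero. -/
def aN (σ : ℝ) (e f : ℕ → ℝ) (N k : ℕ) : ℝ :=
  if h : k < N then blockSol σ e f N (Sum.inl ⟨k, h⟩) else 0

/-- The finite section coefficients `b_N`, extended by zero. -/
def bN (σ : ℝ) (e f : ℕ → ℝ) (N k : ℕ) : ℝ :=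
  if h : k < N then blockSol σ e f N (Sum.inr ⟨k, h⟩) else 0

/-- The finite section approximation `u_N(x) = Σ a_{N,k} P_k(x) + √(1+x) Σ b_{N,k} U_k(x)`. -/
def uN (σ : ℝ) (e f : ℕ → ℝ) (N : ℕ) (x : ℝ) : ℝ :=
  (∑ k ∈ Finset.range N, aN σ e f N k * legendreP k x)
    + √(1 + x) * ∑ k ∈ Finset.range N, bN σ e f N k * chebyshevU k x

/-- Membership in the weighted sequence space `ℓ²_lam`. -/
def MemEll (lam : ℝ) (v : ℕ → ℝ) : Prop :=
  Summable fun k : ℕ => ((k : ℝ) + 1) ^ (2 * lam) * v k ^ 2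

/-- The norm of `ℓ²_lam` (meaningful for sequences in this space). -/
def ellNorm (lam : ℝ) (v : ℕ → ℝ) : ℝ :=
  √(∑' k : ℕ, ((k : ℝ) + 1) ^ (2 * lam) * v k ^ 2)

/-- The right-hand side `e(x) + √(1+x) f(x)` with `e(x) = Σ e_n P_n(x)` and `f(x) = Σ f_n U_n(x)`.
Both series converge absolutely on `[-1,1]` if `Σ |e_n| < ∞` and `Σ (n+1) |f_n| < ∞`. -/
def rhs (e f : ℕ → ℝ) (x : ℝ) : ℝ :=
  (∑' n, e n * legendreP n x) + √(1 + x) * ∑' n, f n * chebyshevU n x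

/-- `u ∈ L²[-1,1]` and `σ u + Q^{1/2} u = e + √(1+x) f` almost everywhere on `[-1,1]`. -/
def IsL2Solution (σ : ℝ) (e f : ℕ → ℝ) (u : ℝ → ℝ) : Prop :=
  MemLp u 2 volI ∧ ∀ᵐ x ∂volI, σ * u x + halfInt u x = rhs e f x

end HalfIntegral

end

noncomputable section

namespace HalfIntegral

/-! ### Expansions in powers of `1 + x` -/

/-- The coefficient of `(1 + x) ^ j` in `legendreP n x`. -/
def legendreCoeff (n j : ℕ) : ℝ :=
  (-1) ^ (n + j) * ((n + j).choose (2 * j) : ℝ) * (j.centralBinom : ℝ) / 2 ^ j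

/-- The coefficient of `(1 + x) ^ j` in `chebyshevU n x`. -/
def chebyshevCoeff (n j : ℕ) : ℝ :=
  (-1) ^ (n + j) * ((n + j + 1).choose (2 * j + 1) : ℝ) * 2 ^ j

lemma legendreCoeff_eq_zero {n j : ℕ} (h : n < j) : legendreCoeff n j = 0 := by
  simp [legendreCoeff, Nat.choose_eq_zero_of_lt (show n + j < 2 * j by omega)]

lemma chebyshevCoeff_eq_zero {n j : ℕ} (h : n < j) : chebyshevCoeff n j = 0 := by
  simp [chebyshevCoeff, Nat.choose_eq_zero_of_lt (show n + j + 1 < 2 * j + 1 by omega)]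

lemma cast_choose_succ_right (m k : ℕ) :
    ((m.choose (k + 1) : ℕ) : ℝ) * ((k : ℝ) + 1) = (m.choose k : ℝ) * ((m : ℝ) - k) := by
  rcases le_or_gt k m with h | h
  · have := Nat.choose_succ_right_eq m k
    rw [← Nat.cast_sub h]
    exact_mod_cast this
  · simp [Nat.choose_eq_zero_of_lt h, Nat.choose_eq_zero_of_lt (Nat.lt_succ_of_lt h)]

lemma cast_choose_succ_succ (m k : ℕ) :
    (((m + 1).choose (k + 1) : ℕ) : ℝ) * ((k : ℝ) + 1) = (m.choose k : ℝ) * ((m : ℝ) + 1) := by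
  have := Nat.add_one_mul_choose_eq m k
  have h2 : (((m + 1) * m.choose k : ℕ) : ℝ) = (((m + 1).choose (k + 1) * (k + 1) : ℕ) : ℝ) := by
    rw [this]
  push_cast at h2
  linarith

lemma cast_centralBinom_succ (j : ℕ) :
    ((j + 1).centralBinom : ℝ) * ((j : ℝ) + 1) = 2 * (2 * j + 1) * (j.centralBinom : ℝ) := by
  have := Nat.succ_mul_centralBinom_succ j
  have h2 : (((j + 1) * (j + 1).centralBinom : ℕ) : ℝ) =
    ((2 * (2 * j + 1) * j.centralBinom : ℕ) : ℝ) := by rw [this]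
  push_cast at h2
  linarith

lemma legendreCoeff_recurrence_zero (n : ℕ) :
    ((n : ℝ) + 2) * legendreCoeff (n + 2) 0
      = -(2 * n + 3) * legendreCoeff (n + 1) 0 - (n + 1) * legendreCoeff n 0 := by
  simp [legendreCoeff, pow_succ]
  ring

lemma legendreCoeff_recurrence_succ (n j : ℕ) :
    ((n : ℝ) + 2) * legendreCoeff (n + 2) (j + 1)
      = (2 * n + 3) * (legendreCoeff (n + 1) j - legendreCoeff (n + 1) (j + 1))
        - (n + 1) * legendreCoeff n (j + 1) := by
  have e1 : n + 2 + (j + 1) = n + 1 + j + 1 + 1 := by ring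
  have e2 : n + 1 + (j + 1) = n + 1 + j + 1 := by ring
  have e3 : n + (j + 1) = n + 1 + j := by ring
  have e4 : 2 * (j + 1) = 2 * j + 1 + 1 := by ring
  unfold legendreCoeff
  rw [e1, e2, e3, e4]
  have h1 := cast_choose_succ_succ (n + 1 + j + 1) (2 * j + 1)
  have h2 := cast_choose_succ_succ (n + 1 + j) (2 * j)
  have h3 := cast_choose_succ_right (n + 1 + j + 1) (2 * j + 1)
  have h4 := cast_choose_succ_right (n + 1 + j) (2 * j + 1)
  have h5 := cast_choose_succ_right (n + 1 + j) (2 * j)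
  have h6 := cast_centralBinom_succ j
  generalize (((n + 1 + j + 1 + 1).choose (2 * j + 1 + 1) : ℕ) : ℝ) = A at *
  generalize (((n + 1 + j + 1).choose (2 * j + 1 + 1) : ℕ) : ℝ) = B at *
  generalize (((n + 1 + j).choose (2 * j + 1 + 1) : ℕ) : ℝ) = D at *
  generalize (((n + 1 + j + 1).choose (2 * j + 1) : ℕ) : ℝ) = E at *
  generalize (((n + 1 + j).choose (2 * j + 1) : ℕ) : ℝ) = F at *
  generalize (((n + 1 + j).choose (2 * j) : ℕ) : ℝ) = q at *
  generalize ((j + 1).centralBinom : ℝ) = c' at *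
  generalize (j.centralBinom : ℝ) = c at *
  push_cast at *
  have hj : (2 * (j : ℝ) + 1) ≠ 0 := by positivity
  have hj2 : (2 * (j : ℝ) + 1 + 1) ≠ 0 := by positivity
  have hj3 : ((j : ℝ) + 1) ≠ 0 := by positivity
  rw [← eq_div_iff hj] at h2 h5
  rw [← eq_div_iff hj2] at h1 h3 h4
  rw [← eq_div_iff hj3] at h6
  subst h2 h5
  subst h1 h3 h4 h6
  have : (-1 : ℝ) ^ (n + 1 + j) ≠ 0 := by positivity
  simp only [pow_succ]
  field_simp
  ring

lemma chebyshevCoeff_recurrence_zero (n : ℕ) :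
    chebyshevCoeff (n + 2) 0 = -2 * chebyshevCoeff (n + 1) 0 - chebyshevCoeff n 0 := by
  simp [chebyshevCoeff, pow_succ]
  ring

lemma chebyshevCoeff_recurrence_succ (n j : ℕ) :
    chebyshevCoeff (n + 2) (j + 1)
      = 2 * (chebyshevCoeff (n + 1) j - chebyshevCoeff (n + 1) (j + 1))
        - chebyshevCoeff n (j + 1) := by
  have e1 : n + 2 + (j + 1) + 1 = n + j + 2 + 1 + 1 := by ring
  have e2 : n + 1 + (j + 1) + 1 = n + j + 2 + 1 := by ring
  have e3 : n + (j + 1) + 1 = n + j + 2 := by ring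
  have e4 : 2 * (j + 1) + 1 = 2 * j + 1 + 1 + 1 := by ring
  have e5 : n + 1 + j + 1 = n + j + 2 := by ring
  unfold chebyshevCoeff
  rw [e1, e2, e3, e4, e5]
  rw [Nat.choose_succ_succ (n + j + 2 + 1), Nat.choose_succ_succ (n + j + 2) (2 * j + 1),
    Nat.choose_succ_succ (n + j + 2) (2 * j + 1 + 1)]
  push_cast
  ring

lemma sum_range_add_one_pow_mul (c : ℕ → ℝ) (M : ℕ) (y : ℝ) :
    ∑ j ∈ Finset.range (M + 1), c j * y ^ j
      = y * ∑ j ∈ Finset.range M, c (j + 1) * y ^ j + c 0 := by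
  rw [Finset.sum_range_succ', Finset.mul_sum]
  simp only [pow_zero, mul_one]
  congr 1
  exact Finset.sum_congr rfl fun j _ => by ring

lemma legendreP_eq_sum (n : ℕ) (x : ℝ) :
    ∀ M, n < M → legendreP n x = ∑ j ∈ Finset.range M, legendreCoeff n j * (1 + x) ^ j := by
  induction n using Nat.twoStepInduction with
  | zero =>
    intro M hM
    rw [Finset.sum_eq_single_of_mem 0 (by simpa using hM)]
    · simp [legendreP, ultraspherical, legendreCoeff]
    · intro j _ hj
      rw [legendreCoeff_eq_zero (Nat.pos_of_ne_zero hj), zero_mul]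
  | one =>
    intro M hM
    have hs : Finset.range 2 ⊆ Finset.range M := Finset.range_subset_range.2 hM
    rw [← Finset.sum_subset hs]
    · simp [legendreP, ultraspherical, legendreCoeff, Finset.sum_range_succ,
        Nat.centralBinom_eq_two_mul_choose]
    · intro j _ hj
      rw [legendreCoeff_eq_zero (by simpa using hj), zero_mul]
  | more n ih1 ih2 =>
    intro M hM
    obtain ⟨M, rfl⟩ : ∃ k, M = k + 1 := ⟨M - 1, by omega⟩
    have h1 := ih2 M (by omega)
    have h1' := ih2 (M + 1) (by omega)
    have h2 := ih1 (M + 1) (by omega)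
    have hrec : ((n : ℝ) + 2) * legendreP (n + 2) x
        = (2 * n + 3) * x * legendreP (n + 1) x - (n + 1) * legendreP n x := by
      simp only [legendreP, ultraspherical]
      field_simp
      ring
    have hn : ((n : ℝ) + 2) ≠ 0 := by positivity
    apply mul_left_cancel₀ hn
    rw [hrec, show (2 * (n : ℝ) + 3) * x * legendreP (n + 1) x
      = (2 * n + 3) * ((1 + x) * legendreP (n + 1) x - legendreP (n + 1) x) by ring]
    nth_rewrite 1 [h1]
    rw [h1', h2]
    rw [sum_range_add_one_pow_mul, sum_range_add_one_pow_mul, sum_range_add_one_pow_mul]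
    have key : ((n : ℝ) + 2) * ∑ j ∈ Finset.range M, legendreCoeff (n + 2) (j + 1) * (1 + x) ^ j
      = (2 * n + 3) * (∑ j ∈ Finset.range M, legendreCoeff (n + 1) j * (1 + x) ^ j
        - ∑ j ∈ Finset.range M, legendreCoeff (n + 1) (j + 1) * (1 + x) ^ j)
        - (n + 1) * ∑ j ∈ Finset.range M, legendreCoeff n (j + 1) * (1 + x) ^ j := by
      rw [← Finset.sum_sub_distrib, Finset.mul_sum, Finset.mul_sum, Finset.mul_sum,
        ← Finset.sum_sub_distrib]
      refine Finset.sum_congr rfl fun j _ => ?_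
      linear_combination (1 + x) ^ j * legendreCoeff_recurrence_succ n j
    linear_combination -(1 + x) * key - legendreCoeff_recurrence_zero n

lemma chebyshevU_add_two (n : ℕ) (x : ℝ) :
    chebyshevU (n + 2) x = 2 * x * chebyshevU (n + 1) x - chebyshevU n x := by
  have := Polynomial.Chebyshev.U_add_two ℝ (n : ℤ)
  unfold chebyshevU
  push_cast
  rw [this]
  simp

lemma chebyshevU_eq_sum (n : ℕ) (x : ℝ) :
    ∀ M, n < M → chebyshevU n x = ∑ j ∈ Finset.range M, chebyshevCoeff n j * (1 + x) ^ j := by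
  induction n using Nat.twoStepInduction with
  | zero =>
    intro M hM
    rw [Finset.sum_eq_single_of_mem 0 (by simpa using hM)]
    · simp [chebyshevU, chebyshevCoeff]
    · intro j _ hj
      rw [chebyshevCoeff_eq_zero (Nat.pos_of_ne_zero hj), zero_mul]
  | one =>
    intro M hM
    have hs : Finset.range 2 ⊆ Finset.range M := Finset.range_subset_range.2 hM
    rw [← Finset.sum_subset hs]
    · simp [chebyshevU, chebyshevCoeff, Finset.sum_range_succ]
      ring
    · intro j _ hj
      rw [chebyshevCoeff_eq_zero (by simpa using hj), zero_mul]
  | more n ih1 ih2 =>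
    intro M hM
    obtain ⟨M, rfl⟩ : ∃ k, M = k + 1 := ⟨M - 1, by omega⟩
    have h1 := ih2 M (by omega)
    have h1' := ih2 (M + 1) (by omega)
    have h2 := ih1 (M + 1) (by omega)
    rw [chebyshevU_add_two, show 2 * x * chebyshevU (n + 1) x
      = 2 * ((1 + x) * chebyshevU (n + 1) x - chebyshevU (n + 1) x) by ring]
    nth_rewrite 1 [h1]
    rw [h1', h2]
    rw [sum_range_add_one_pow_mul, sum_range_add_one_pow_mul, sum_range_add_one_pow_mul]
    have key : ∑ j ∈ Finset.range M, chebyshevCoeff (n + 2) (j + 1) * (1 + x) ^ j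
      = 2 * (∑ j ∈ Finset.range M, chebyshevCoeff (n + 1) j * (1 + x) ^ j
        - ∑ j ∈ Finset.range M, chebyshevCoeff (n + 1) (j + 1) * (1 + x) ^ j)
        - ∑ j ∈ Finset.range M, chebyshevCoeff n (j + 1) * (1 + x) ^ j := by
      rw [← Finset.sum_sub_distrib, Finset.mul_sum, ← Finset.sum_sub_distrib]
      refine Finset.sum_congr rfl fun j _ => ?_
      linear_combination (1 + x) ^ j * chebyshevCoeff_recurrence_succ n j
    linear_combination -(1 + x) * key - chebyshevCoeff_recurrence_zero n

/-! ### Half-integrals of powers of `1 + t` -/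

lemma integral_rpow_mul_sub_rpow {a p : ℝ} (ha : 0 < a) (hp : -1 < p) :
    ∫ t in (0 : ℝ)..a, t ^ p * (a - t) ^ (-(1 / 2) : ℝ)
      = a ^ (p + 1 / 2) * ProbabilityTheory.beta (p + 1) (1 / 2) := by
  have h := Complex.betaIntegral_scaled ((p + 1 : ℝ) : ℂ) ((1 / 2 : ℝ) : ℂ) ha
  have hb := Complex.betaIntegral_eq_Gamma_mul_div ((p + 1 : ℝ) : ℂ) ((1 / 2 : ℝ) : ℂ)
    (by simp; linarith) (by simp)
  rw [hb, ← Complex.ofReal_add, Complex.Gamma_ofReal, Complex.Gamma_ofReal,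
    Complex.Gamma_ofReal, ← Complex.ofReal_one, ← Complex.ofReal_sub,
    ← Complex.ofReal_sub, ← Complex.ofReal_sub, ← Complex.ofReal_cpow ha.le, ← Complex.ofReal_mul,
    ← Complex.ofReal_div, ← Complex.ofReal_mul] at h
  apply Complex.ofReal_injective
  rw [ProbabilityTheory.beta, show p + 1 / 2 = p + 1 + 1 / 2 - 1 by ring, ← h,
    ← intervalIntegral.integral_ofReal]
  refine intervalIntegral.integral_congr_ae (Eventually.of_forall fun t ht => ?_)
  rw [Set.uIoc_of_le ha.le] at ht
  have h1 : 0 ≤ a - t := by linarith [ht.2]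
  rw [Complex.ofReal_mul, Complex.ofReal_cpow ht.1.le, Complex.ofReal_cpow h1]
  simp only [add_sub_cancel_right, Complex.ofReal_sub]
  congr 2
  push_cast
  norm_num

lemma intervalIntegrable_inv_sqrt_sub {a x : ℝ} (hx : a ≤ x) :
    IntervalIntegrable (fun t => 1 / √(x - t)) volume a x := by
  have h : IntervalIntegrable (fun t : ℝ => t ^ (-(1 / 2) : ℝ)) volume (x - a) (x - x) :=
    intervalIntegral.intervalIntegrable_rpow' (by norm_num)
  have h2 := h.comp_sub_left x
  simp only [sub_sub_cancel, sub_self, sub_zero] at h2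
  refine h2.congr fun t ht => ?_
  rw [Set.uIoc_of_le hx] at ht
  rw [Real.rpow_neg (by linarith [ht.2]), ← Real.sqrt_eq_rpow, one_div]

lemma integral_rpow_div_sqrt {x p : ℝ} (hx : -1 ≤ x) (hp : 0 ≤ p) :
    ∫ t in (-1 : ℝ)..x, (1 + t) ^ p / √(x - t)
      = (1 + x) ^ (p + 1 / 2) * ProbabilityTheory.beta (p + 1) (1 / 2) := by
  rcases hx.eq_or_lt with rfl | hx
  · simp [Real.zero_rpow (show p + 2⁻¹ ≠ 0 by positivity)]
  rw [← integral_rpow_mul_sub_rpow (show 0 < 1 + x by linarith) (by linarith)]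
  have h := intervalIntegral.integral_comp_add_left (a := -1) (b := x)
    (fun t : ℝ => t ^ p * ((1 + x) - t) ^ (-(1 / 2) : ℝ)) 1
  simp only [show (1 : ℝ) + -1 = 0 by norm_num, add_sub_add_left_eq_sub] at h
  rw [← h]
  refine intervalIntegral.integral_congr_ae (Eventually.of_forall fun t ht => ?_)
  rw [Set.uIoc_of_le hx.le] at ht
  rw [Real.rpow_neg (by linarith [ht.2]), ← Real.sqrt_eq_rpow, div_eq_mul_inv]

lemma beta_nat_add_one_half (j : ℕ) :
    ProbabilityTheory.beta ((j : ℝ) + 1) (1 / 2)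
      = 2 * 4 ^ j / ((2 * j + 1) * (j.centralBinom : ℝ)) := by
  unfold ProbabilityTheory.beta
  induction j with
  | zero =>
    rw [show ((0 : ℕ) : ℝ) + 1 + 1 / 2 = 1 / 2 + 1 by norm_num,
      Real.Gamma_add_one (show (1 / 2 : ℝ) ≠ 0 by norm_num), Nat.cast_zero, zero_add, Real.Gamma_one]
    have : Real.Gamma (1 / 2) ≠ 0 := (Real.Gamma_pos_of_pos (by norm_num)).ne'
    rw [Nat.centralBinom_zero]
    field_simp
    norm_num
  | succ j ih =>
    push_cast
    rw [show (j : ℝ) + 1 + 1 + 1 / 2 = (j + 1 + 1 / 2) + 1 by ring,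
      Real.Gamma_add_one (show (j : ℝ) + 1 + 1 / 2 ≠ 0 by positivity),
      Real.Gamma_add_one (show (j : ℝ) + 1 ≠ 0 by positivity)]
    have h1 := cast_centralBinom_succ j
    have h2 : ((j + 1).centralBinom : ℝ) ≠ 0 := by
      exact_mod_cast (Nat.centralBinom_pos _).ne'
    have h3 : (j.centralBinom : ℝ) ≠ 0 := by
      exact_mod_cast (Nat.centralBinom_pos _).ne'
    have h4 : Real.Gamma ((j : ℝ) + 1 + 1 / 2) ≠ 0 :=
      (Real.Gamma_pos_of_pos (by positivity)).ne'
    have h5 : ((j : ℝ) + 1) * Real.Gamma (↑j + 1) * Real.Gamma (1 / 2)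
        / ((↑j + 1 + 1 / 2) * Real.Gamma (↑j + 1 + 1 / 2))
        = ((j : ℝ) + 1) / (↑j + 1 + 1 / 2) * (Real.Gamma (↑j + 1) * Real.Gamma (1 / 2)
        / (Real.Gamma (↑j + 1 + 1 / 2))) := by
      field_simp
    rw [h5, ih]
    have h6 : ((j + 1).centralBinom : ℝ) = 2 * (2 * j + 1) * (j.centralBinom : ℝ) / (j + 1) := by
      rw [eq_div_iff (by positivity), h1]
    rw [h6]
    have : (2 * ((j : ℝ) + 1) + 1) ≠ 0 := by positivity
    field_simp
    ring

lemma beta_nat_add_three_halves (j : ℕ) :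
    ProbabilityTheory.beta ((j : ℝ) + 1 / 2 + 1) (1 / 2)
      = Real.pi * ((j + 1).centralBinom : ℝ) / (2 * 4 ^ j * 2) := by
  unfold ProbabilityTheory.beta
  induction j with
  | zero =>
    rw [show ((0 : ℕ) : ℝ) + 1 / 2 + 1 + 1 / 2 = 1 + 1 by norm_num,
      show ((0 : ℕ) : ℝ) + 1 / 2 + 1 = 1 / 2 + 1 by norm_num,
      Real.Gamma_add_one (by norm_num), Real.Gamma_add_one (by norm_num), Real.Gamma_one_half_eq,
      Real.Gamma_one]
    have := Real.mul_self_sqrt Real.pi_pos.le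
    simp [Nat.centralBinom_eq_two_mul_choose]
    linarith
  | succ j ih =>
    push_cast
    rw [show (j : ℝ) + 1 + 1 / 2 + 1 + 1 / 2 = (j + 1 / 2 + 1 + 1 / 2) + 1 by ring,
      show (j : ℝ) + 1 + 1 / 2 + 1 = (j + 1 / 2 + 1) + 1 by ring,
      Real.Gamma_add_one (show (j : ℝ) + 1 / 2 + 1 + 1 / 2 ≠ 0 by positivity),
      Real.Gamma_add_one (show (j : ℝ) + 1 / 2 + 1 ≠ 0 by positivity)]
    have h1 := cast_centralBinom_succ (j + 1)
    have h4 : Real.Gamma ((j : ℝ) + 1 / 2 + 1 + 1 / 2) ≠ 0 :=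
      (Real.Gamma_pos_of_pos (by positivity)).ne'
    have h5 : ((j : ℝ) + 1 / 2 + 1) * Real.Gamma (↑j + 1 / 2 + 1) * Real.Gamma (1 / 2)
        / ((↑j + 1 / 2 + 1 + 1 / 2) * Real.Gamma (↑j + 1 / 2 + 1 + 1 / 2))
        = ((j : ℝ) + 1 / 2 + 1) / (↑j + 1 / 2 + 1 + 1 / 2)
          * (Real.Gamma (↑j + 1 / 2 + 1) * Real.Gamma (1 / 2)
        / (Real.Gamma (↑j + 1 / 2 + 1 + 1 / 2))) := by
      field_simp
    rw [h5, ih]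
    push_cast at h1
    rw [← eq_div_iff (by positivity)] at h1
    rw [h1]
    field_simp
    ring

lemma halfInt_pow {x : ℝ} (hx : -1 ≤ x) (j : ℕ) :
    halfInt (fun t => (1 + t) ^ j) x
      = √(1 + x) * (2 / √Real.pi * (4 ^ j / ((2 * j + 1) * (j.centralBinom : ℝ))))
        * (1 + x) ^ j := by
  have h := integral_rpow_div_sqrt hx (Nat.cast_nonneg j : (0 : ℝ) ≤ j)
  simp only [Real.rpow_natCast] at h
  have h0 : 0 ≤ 1 + x := by linarith
  rw [halfInt, h, beta_nat_add_one_half, Real.rpow_add_of_nonneg h0 (by positivity) (by positivity),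
    Real.rpow_natCast, ← Real.sqrt_eq_rpow]
  ring

lemma halfInt_sqrt_mul_pow {x : ℝ} (hx : -1 ≤ x) (j : ℕ) :
    halfInt (fun t => √(1 + t) * (1 + t) ^ j) x
      = √Real.pi * (((j + 1).centralBinom : ℝ) / (2 * 4 ^ j * 2)) * (1 + x) ^ (j + 1) := by
  have h := integral_rpow_div_sqrt hx (by positivity : (0 : ℝ) ≤ (j : ℝ) + 1 / 2)
  have h0 : 0 ≤ 1 + x := by linarith
  rw [beta_nat_add_three_halves, show (j : ℝ) + 1 / 2 + 1 / 2 = ((j + 1 : ℕ) : ℝ) by push_cast; ring,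
    Real.rpow_natCast] at h
  have h2 : ∫ t in (-1 : ℝ)..x, √(1 + t) * (1 + t) ^ j / √(x - t)
      = ∫ t in (-1 : ℝ)..x, (1 + t) ^ ((j : ℝ) + 1 / 2) / √(x - t) := by
    refine intervalIntegral.integral_congr_ae (Eventually.of_forall fun t ht => ?_)
    rw [Set.uIoc_of_le hx] at ht
    rw [Real.rpow_add_of_nonneg (by linarith [ht.1]) (by positivity) (by positivity),
      Real.rpow_natCast, ← Real.sqrt_eq_rpow, mul_comm]
  rw [halfInt, h2, h]
  have := Real.mul_self_sqrt Real.pi_pos.le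
  have h3 : √Real.pi ≠ 0 := by positivity
  field_simp
  rw [Real.sq_sqrt Real.pi_pos.le]
  ring

lemma intervalIntegrable_div_sqrt_sub {u : ℝ → ℝ} {x : ℝ} (hx : -1 ≤ x)
    (hu : ContinuousOn u (Set.Icc (-1) x)) :
    IntervalIntegrable (fun t => u t / √(x - t)) volume (-1) x := by
  have := (intervalIntegrable_inv_sqrt_sub hx).continuousOn_mul
    (show ContinuousOn u (Set.uIcc (-1) x) by rwa [Set.uIcc_of_le hx])
  refine this.congr ?_
  exact fun t _ => by simp [div_eq_mul_inv]

lemma halfInt_const_mul (c : ℝ) (u : ℝ → ℝ) (x : ℝ) :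
    halfInt (fun t => c * u t) x = c * halfInt u x := by
  simp only [halfInt, mul_div_assoc, intervalIntegral.integral_const_mul]
  ring

lemma halfInt_finset_sum {ι : Type*} (s : Finset ι) (u : ι → ℝ → ℝ) {x : ℝ} (hx : -1 ≤ x)
    (hu : ∀ i ∈ s, ContinuousOn (u i) (Set.Icc (-1) x)) :
    halfInt (fun t => ∑ i ∈ s, u i t) x = ∑ i ∈ s, halfInt (u i) x := by
  simp only [halfInt, Finset.sum_div]
  rw [intervalIntegral.integral_finsetSum fun i hi =>
    intervalIntegrable_div_sqrt_sub hx (hu i hi), Finset.mul_sum]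

/-- The Chebyshev differences `U_n - U_{n-1}`, with `U_{-1} = 0`. -/
def chebyshevDiff : ℕ → ℝ → ℝ
  | 0, x => chebyshevU 0 x
  | n + 1, x => chebyshevU (n + 1) x - chebyshevU n x

lemma legendreCoeff_half (n j : ℕ) :
    legendreCoeff n j * (4 ^ j / ((2 * j + 1) * (j.centralBinom : ℝ))) * (2 * n + 1)
      = chebyshevCoeff n j + (-1) ^ (n + j) * ((n + j).choose (2 * j + 1) : ℝ) * 2 ^ j := by
  have h3 : (j.centralBinom : ℝ) ≠ 0 := by exact_mod_cast (Nat.centralBinom_pos _).ne'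
  have h4 : (2 * (j : ℝ) + 1) ≠ 0 := by positivity
  have h := cast_choose_succ_right (n + j) (2 * j)
  unfold legendreCoeff chebyshevCoeff
  rw [Nat.choose_succ_succ (n + j) (2 * j)]
  push_cast at h ⊢
  rw [← eq_div_iff h4] at h
  rw [h, show (4 : ℝ) = 2 * 2 by norm_num, mul_pow]
  field_simp
  ring

theorem halfInt_legendreP (n : ℕ) {x : ℝ} (hx : -1 ≤ x) :
    halfInt (legendreP n) x
      = 2 / (√Real.pi * (2 * n + 1)) * (√(1 + x) * chebyshevDiff n x) := by
  have h1 : legendreP n = fun t => ∑ j ∈ Finset.range (n + 1),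
      legendreCoeff n j * (1 + t) ^ j := by
    funext t
    exact legendreP_eq_sum n t _ n.lt_succ_self
  rw [h1, halfInt_finset_sum _ _ hx (fun i _ => by fun_prop)]
  have h2 : (2 * (n : ℝ) + 1) ≠ 0 := by positivity
  have hd : chebyshevDiff n x = ∑ j ∈ Finset.range (n + 1), (chebyshevCoeff n j
      + (-1) ^ (n + j) * ((n + j).choose (2 * j + 1) : ℝ) * 2 ^ j) * (1 + x) ^ j := by
    cases n with
    | zero => simp [chebyshevDiff, chebyshevU, chebyshevCoeff]
    | succ n =>
      rw [chebyshevDiff, chebyshevU_eq_sum (n + 1) x _ (n + 1).lt_succ_self,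
        chebyshevU_eq_sum n x (n + 1 + 1) (by omega), ← Finset.sum_sub_distrib]
      refine Finset.sum_congr rfl fun j _ => ?_
      rw [show chebyshevCoeff n j = -((-1) ^ (n + 1 + j) *
        ((n + 1 + j).choose (2 * j + 1) : ℝ) * 2 ^ j) by
          rw [chebyshevCoeff, show n + 1 + j = n + j + 1 by ring, pow_succ]; ring]
      ring
  rw [hd, Finset.mul_sum, Finset.mul_sum]
  refine Finset.sum_congr rfl fun j _ => ?_
  rw [halfInt_const_mul, halfInt_pow hx, ← legendreCoeff_half]
  have h3 : √Real.pi ≠ 0 := by positivity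
  field_simp

lemma chebyshevCoeff_half (n j : ℕ) :
    chebyshevCoeff n j * (((j + 1).centralBinom : ℝ) / (4 ^ j * 2))
      = legendreCoeff n (j + 1) + legendreCoeff (n + 1) (j + 1) := by
  unfold legendreCoeff chebyshevCoeff
  rw [show n + 1 + (j + 1) = n + j + 1 + 1 by ring, show n + (j + 1) = n + j + 1 by ring,
    show 2 * (j + 1) = 2 * j + 1 + 1 by ring, Nat.choose_succ_succ (n + j + 1) (2 * j + 1),
    show (4 : ℝ) = 2 * 2 by norm_num, mul_pow]
  push_cast
  field_simp
  ring

theorem halfInt_sqrt_mul_chebyshevU (n : ℕ) {x : ℝ} (hx : -1 ≤ x) :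
    halfInt (fun t => √(1 + t) * chebyshevU n t) x
      = √Real.pi / 2 * (legendreP n x + legendreP (n + 1) x) := by
  have h1 : (fun t => √(1 + t) * chebyshevU n t) = fun t => ∑ j ∈ Finset.range (n + 1),
      chebyshevCoeff n j * (√(1 + t) * (1 + t) ^ j) := by
    funext t
    rw [chebyshevU_eq_sum n t _ n.lt_succ_self, Finset.mul_sum]
    exact Finset.sum_congr rfl fun j _ => by ring
  rw [h1, halfInt_finset_sum _ _ hx (fun i _ => by fun_prop)]
  rw [legendreP_eq_sum n x (n + 1 + 1) (by omega), legendreP_eq_sum (n + 1) x (n + 1 + 1) (by omega),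
    sum_range_add_one_pow_mul _ (n + 1), sum_range_add_one_pow_mul _ (n + 1)]
  have h0 : legendreCoeff n 0 + legendreCoeff (n + 1) 0 = 0 := by
    simp [legendreCoeff, pow_succ]
  have h2 : (1 + x) * ∑ j ∈ Finset.range (n + 1), legendreCoeff n (j + 1) * (1 + x) ^ j
      + (1 + x) * ∑ j ∈ Finset.range (n + 1), legendreCoeff (n + 1) (j + 1) * (1 + x) ^ j
      = ∑ j ∈ Finset.range (n + 1), (legendreCoeff n (j + 1) + legendreCoeff (n + 1) (j + 1))
        * (1 + x) ^ (j + 1) := by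
    rw [Finset.mul_sum, Finset.mul_sum, ← Finset.sum_add_distrib]
    exact Finset.sum_congr rfl fun j _ => by ring
  rw [show ∀ a b c d : ℝ, a + b + (c + d) = (a + c) + (b + d) by intros; ring, h0, h2, add_zero,
    Finset.mul_sum]
  refine Finset.sum_congr rfl fun j _ => ?_
  rw [halfInt_const_mul, halfInt_sqrt_mul_pow hx, ← chebyshevCoeff_half]
  field_simp

/-! ### Bounds for the basis functions -/

lemma continuous_legendreP (n : ℕ) : Continuous (legendreP n) := by
  have h1 : legendreP n = fun t => ∑ j ∈ Finset.range (n + 1),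
      legendreCoeff n j * (1 + t) ^ j := by
    funext t
    exact legendreP_eq_sum n t _ n.lt_succ_self
  rw [h1]
  fun_prop

lemma continuous_chebyshevU (n : ℕ) : Continuous (chebyshevU n) := by
  unfold chebyshevU
  fun_prop

lemma legendreP_one (n : ℕ) : legendreP n 1 = 1 := by
  induction n using Nat.twoStepInduction with
  | zero => simp [legendreP, ultraspherical]
  | one => simp [legendreP, ultraspherical]
  | more n ih1 ih2 =>
    simp only [legendreP] at *
    rw [ultraspherical, ih1, ih2]
    have hn : ((n : ℝ) + 2) ≠ 0 := by positivity
    field_simp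
    ring

lemma abs_chebyshevU_le (n : ℕ) {x : ℝ} (hx : x ∈ Set.Icc (-1 : ℝ) 1) :
    |chebyshevU n x| ≤ n + 1 := by
  have hx' : |x| ≤ 1 := abs_le.2 hx
  induction n with
  | zero => simp [chebyshevU]
  | succ n ih =>
    have h := congrArg (Polynomial.eval x) (Polynomial.Chebyshev.U_eq_X_mul_U_add_T ℝ (n : ℤ))
    have hT := Polynomial.Chebyshev.abs_eval_T_real_le_one (n + 1) hx'
    simp only [Polynomial.eval_add, Polynomial.eval_mul, Polynomial.eval_X] at h
    rw [chebyshevU] at *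
    push_cast
    rw [h]
    refine (abs_add_le _ _).trans (add_le_add ?_ hT)
    rw [abs_mul]
    exact (mul_le_of_le_one_left (abs_nonneg _) hx').trans ih

lemma one_le_sqrt_pi : 1 ≤ √Real.pi := by
  rw [Real.one_le_sqrt]
  linarith [Real.pi_gt_three]

lemma integral_one_div_sqrt_sub {x : ℝ} (hx : -1 ≤ x) :
    ∫ t in (-1 : ℝ)..x, 1 / √(x - t) = 2 * √(1 + x) := by
  have h := integral_rpow_div_sqrt hx le_rfl
  have h2 := beta_nat_add_one_half 0
  simp only [Nat.cast_zero] at h2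
  rw [h2] at h
  simp only [Real.rpow_zero, zero_add] at h
  rw [h, ← Real.sqrt_eq_rpow]
  simp
  ring

lemma sqrt_one_add_le {x : ℝ} (hx : x ∈ Set.Icc (-1 : ℝ) 1) : √(1 + x) ≤ 2 :=
  Real.sqrt_le_iff.2 ⟨by norm_num, by linarith [hx.2]⟩

lemma abs_halfInt_le {u : ℝ → ℝ} {B x : ℝ} (hB : ∀ t ∈ Set.Icc (-1 : ℝ) 1, |u t| ≤ B)
    (hx : x ∈ Set.Icc (-1 : ℝ) 1) : |halfInt u x| ≤ 4 * B := by
  have hB0 : 0 ≤ B := (abs_nonneg _).trans (hB x hx)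
  have h1 : |∫ t in (-1 : ℝ)..x, u t / √(x - t)| ≤ ∫ t in (-1 : ℝ)..x, B * (1 / √(x - t)) := by
    rw [← Real.norm_eq_abs]
    refine intervalIntegral.norm_integral_le_of_norm_le hx.1 (Eventually.of_forall fun t ht => ?_)
      ((intervalIntegrable_inv_sqrt_sub hx.1).const_mul B)
    rw [norm_div, Real.norm_eq_abs, Real.norm_eq_abs, abs_of_nonneg (Real.sqrt_nonneg _),
      div_eq_mul_one_div]
    exact mul_le_mul_of_nonneg_right (hB t ⟨ht.1.le, ht.2.trans hx.2⟩) (by positivity)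
  rw [intervalIntegral.integral_const_mul, integral_one_div_sqrt_sub hx.1] at h1
  rw [halfInt, abs_mul, abs_of_nonneg (by positivity : 0 ≤ 1 / √Real.pi)]
  have h2 : 1 / √Real.pi ≤ 1 := by
    rw [div_le_one (by positivity)]
    exact one_le_sqrt_pi
  refine (mul_le_of_le_one_left (abs_nonneg _) h2).trans (h1.trans ?_)
  nlinarith [mul_le_mul_of_nonneg_left (sqrt_one_add_le hx) hB0]

lemma abs_legendreP_le (n : ℕ) {x : ℝ} (hx : x ∈ Set.Icc (-1 : ℝ) 1) :
    |legendreP n x| ≤ 16 * ((n : ℝ) + 1) ^ 2 := by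
  induction n with
  | zero => simp [legendreP, ultraspherical]
  | succ n ih =>
    have h := halfInt_sqrt_mul_chebyshevU n hx.1
    have hb : |halfInt (fun t => √(1 + t) * chebyshevU n t) x| ≤ 4 * (2 * (n + 1)) := by
      refine abs_halfInt_le (fun t ht => ?_) hx
      rw [abs_mul, abs_of_nonneg (Real.sqrt_nonneg _)]
      exact mul_le_mul (sqrt_one_add_le ht) (abs_chebyshevU_le n ht) (abs_nonneg _) (by norm_num)
    rw [h, abs_mul, abs_of_nonneg (by positivity : 0 ≤ √Real.pi / 2)] at hb
    have h2 : |legendreP n x + legendreP (n + 1) x| ≤ 16 * (n + 1) := by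
      nlinarith [mul_le_mul_of_nonneg_right one_le_sqrt_pi
        (abs_nonneg (legendreP n x + legendreP (n + 1) x))]
    have h3 : |legendreP (n + 1) x| ≤ |legendreP n x + legendreP (n + 1) x| + |legendreP n x| := by
      have := abs_sub (legendreP n x + legendreP (n + 1) x) (legendreP n x)
      rwa [add_sub_cancel_left] at this
    push_cast
    nlinarith [(Nat.cast_nonneg n : (0 : ℝ) ≤ n)]

/-! ### Uniqueness for the half-integral equation -/

instance : IsFiniteMeasure volI := by
  unfold volI
  infer_instance

lemma lintegral_exp_div_sqrt {μ : ℝ} (hμ : 0 < μ) :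
    ∫⁻ τ : ℝ, ENNReal.ofReal (if 0 < τ then Real.exp (-(μ * τ)) / √τ else 0)
      = ENNReal.ofReal (√Real.pi / √μ) := by
  have hval := Real.integral_rpow_mul_exp_neg_mul_Ioi (a := 1 / 2) (r := μ) (by norm_num) hμ
  rw [Real.Gamma_one_half_eq, ← Real.sqrt_eq_rpow, one_div μ, Real.sqrt_inv, one_div] at hval
  have hpos : 0 < (√μ)⁻¹ * √Real.pi := by positivity
  have hint : IntegrableOn (fun t : ℝ => t ^ ((2 : ℝ)⁻¹ - 1) * Real.exp (-(μ * t)))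
      (Set.Ioi 0) := by
    by_contra h
    rw [integral_undef h] at hval
    exact hpos.ne hval
  have hfun : (fun τ : ℝ => ENNReal.ofReal (if 0 < τ then Real.exp (-(μ * τ)) / √τ else 0))
      = (Set.Ioi (0 : ℝ)).indicator
        (fun t => ENNReal.ofReal (t ^ ((2 : ℝ)⁻¹ - 1) * Real.exp (-(μ * t)))) := by
    funext τ
    by_cases h : 0 < τ
    · rw [if_pos h, Set.indicator_of_mem (by exact h), show (2 : ℝ)⁻¹ - 1 = -(1 / 2) by norm_num,
        Real.rpow_neg h.le, ← Real.sqrt_eq_rpow, div_eq_mul_inv, mul_comm]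
    · rw [if_neg h, Set.indicator_of_notMem (by exact h), ENNReal.ofReal_zero]
  rw [hfun, lintegral_indicator measurableSet_Ioi, ← ofReal_integral_eq_lintegral_ofReal hint,
    hval, div_eq_inv_mul]
  filter_upwards [ae_restrict_mem measurableSet_Ioi] with t ht
  have : (0 : ℝ) < t := ht
  simp only [Pi.zero_apply]
  positivity

/-- The kernel `τ ↦ τ^{-1/2}` on the positive half-line, extended by zero. -/
def halfKernel (τ : ℝ) : ENNReal := ENNReal.ofReal (if 0 < τ then 1 / √τ else 0)

lemma measurable_halfKernel : Measurable halfKernel := by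
  unfold halfKernel
  refine ENNReal.measurable_ofReal.comp ?_
  refine Measurable.ite (measurableSet_lt measurable_const measurable_id) ?_ measurable_const
  fun_prop

lemma lintegral_exp_mul_halfKernel_le {μ : ℝ} (hμ : 0 < μ) {g : ℝ → ENNReal}
    (hg : AEMeasurable g volI) :
    ∫⁻ x, ENNReal.ofReal (Real.exp (-(μ * x))) * ∫⁻ t, g t * halfKernel (x - t) ∂volI ∂volI
      ≤ ENNReal.ofReal (√Real.pi / √μ)
        * ∫⁻ t, ENNReal.ofReal (Real.exp (-(μ * t))) * g t ∂volI := by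
  have hK : Measurable fun p : ℝ × ℝ => ENNReal.ofReal
      (if 0 < p.1 - p.2 then Real.exp (-(μ * (p.1 - p.2))) / √(p.1 - p.2) else 0) := by
    refine ENNReal.measurable_ofReal.comp ?_
    refine Measurable.ite (measurableSet_lt measurable_const (by fun_prop)) ?_ measurable_const
    fun_prop
  have hg2 : AEMeasurable (fun p : ℝ × ℝ => g p.2) (volI.prod volI) :=
    hg.comp_quasiMeasurePreserving Measure.quasiMeasurePreserving_snd
  have hstep : ∀ x, ENNReal.ofReal (Real.exp (-(μ * x))) * ∫⁻ t, g t * halfKernel (x - t) ∂volI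
      = ∫⁻ t, (ENNReal.ofReal (Real.exp (-(μ * t))) * g t) * ENNReal.ofReal
        (if 0 < x - t then Real.exp (-(μ * (x - t))) / √(x - t) else 0) ∂volI := by
    intro x
    rw [← lintegral_const_mul' _ _ ENNReal.ofReal_ne_top]
    refine lintegral_congr fun t => ?_
    unfold halfKernel
    by_cases h : 0 < x - t
    · rw [if_pos h, if_pos h, mul_left_comm, ← ENNReal.ofReal_mul (Real.exp_pos _).le,
        mul_comm _ (g t), mul_assoc, ← ENNReal.ofReal_mul (Real.exp_pos _).le, mul_div_assoc',
        mul_div_assoc', ← Real.exp_add, mul_one]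
      congr 4
      ring
    · rw [if_neg h, if_neg h]
      simp
  simp_rw [hstep]
  rw [lintegral_lintegral_swap]
  · rw [← lintegral_const_mul' _ _ ENNReal.ofReal_ne_top]
    refine lintegral_mono fun t => ?_
    have hKt : Measurable fun x => ENNReal.ofReal
        (if 0 < x - t then Real.exp (-(μ * (x - t))) / √(x - t) else 0) :=
      hK.comp (measurable_id.prodMk measurable_const)
    rw [lintegral_const_mul _ hKt, mul_comm]
    refine mul_le_mul_left ?_ _
    refine (lintegral_mono' Measure.restrict_le_self le_rfl).trans ?_
    rw [lintegral_sub_right_eq_self (fun y => ENNReal.ofReal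
      (if 0 < y then Real.exp (-(μ * y)) / √y else 0)) t, lintegral_exp_div_sqrt hμ]
  · refine AEMeasurable.mul (AEMeasurable.mul ?_ hg2) hK.aemeasurable
    fun_prop

lemma lintegral_exp_mul_lt_top (μ : ℝ) {v : ℝ → ℝ} (hv : Integrable v volI) :
    ∫⁻ t, ENNReal.ofReal (Real.exp (-(μ * t))) * ‖v t‖ₑ ∂volI < ⊤ := by
  have h1 : ∫⁻ t, ENNReal.ofReal (Real.exp (-(μ * t))) * ‖v t‖ₑ ∂volI
      ≤ ∫⁻ t, ENNReal.ofReal (Real.exp |μ|) * ‖v t‖ₑ ∂volI := by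
    refine lintegral_mono_ae ?_
    filter_upwards [ae_restrict_mem (μ := volume) (s := Set.Icc (-1 : ℝ) 1) measurableSet_Icc]
      with t ht
    gcongr
    have h2 : |t| ≤ 1 := abs_le.2 ht
    calc -(μ * t) ≤ |μ * t| := neg_le_abs _
      _ = |μ| * |t| := abs_mul _ _
      _ ≤ |μ| := mul_le_of_le_one_right (abs_nonneg _) h2
  refine h1.trans_lt ?_
  rw [lintegral_const_mul'' _ hv.aestronglyMeasurable.enorm]
  exact ENNReal.mul_lt_top ENNReal.ofReal_lt_top hv.hasFiniteIntegral

lemma lintegral_Ioc_div_sqrt_le (v : ℝ → ℝ) {x : ℝ} (hx : x ∈ Set.Icc (-1 : ℝ) 1) :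
    ∫⁻ t in Set.Ioc (-1) x, ‖v t / √(x - t)‖ₑ ≤ ∫⁻ t, ‖v t‖ₑ * halfKernel (x - t) ∂volI := by
  have h1 : ∫⁻ t in Set.Ioc (-1) x, ‖v t / √(x - t)‖ₑ
      ≤ ∫⁻ t in Set.Ioc (-1) x, ‖v t‖ₑ * halfKernel (x - t) := by
    refine setLIntegral_mono' measurableSet_Ioc fun t ht => ?_
    rw [div_eq_mul_one_div, enorm_mul]
    gcongr
    rw [Real.enorm_eq_ofReal (by positivity), halfKernel]
    split_ifs with h
    · exact le_rfl
    · rw [show x - t = 0 by linarith [ht.2]]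
      simp
  have h2 : Set.Ioc (-1) x ⊆ Set.Icc (-1) 1 := fun t ht => ⟨ht.1.le, ht.2.trans hx.2⟩
  exact h1.trans (lintegral_mono' (Measure.restrict_mono h2 le_rfl) le_rfl)

lemma ae_intervalIntegrable_div_sqrt {v : ℝ → ℝ} (hv : Integrable v volI) :
    ∀ᵐ x ∂volI, IntervalIntegrable (fun t => v t / √(x - t)) volume (-1) x := by
  have hg : AEMeasurable (fun t => ‖v t‖ₑ) volI := hv.aestronglyMeasurable.enorm
  have h1 := lintegral_exp_mul_halfKernel_le one_pos hg
  have h2 := h1.trans_lt (ENNReal.mul_lt_top ENNReal.ofReal_lt_top (lintegral_exp_mul_lt_top 1 hv))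
  have hm : AEMeasurable (fun x => ENNReal.ofReal (Real.exp (-(1 * x)))
      * ∫⁻ t, ‖v t‖ₑ * halfKernel (x - t) ∂volI) volI := by
    refine AEMeasurable.mul (by fun_prop) (AEMeasurable.lintegral_prod_right'
      (f := fun p : ℝ × ℝ => ‖v p.2‖ₑ * halfKernel (p.1 - p.2)) ?_)
    refine AEMeasurable.mul (hg.comp_quasiMeasurePreserving
      Measure.quasiMeasurePreserving_snd) ?_
    exact (measurable_halfKernel.comp (measurable_fst.sub measurable_snd)).aemeasurable
  filter_upwards [ae_lt_top' hm h2.ne,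
    ae_restrict_mem (μ := volume) (s := Set.Icc (-1 : ℝ) 1) measurableSet_Icc] with x hx hxI
  rw [intervalIntegrable_iff_integrableOn_Ioc_of_le hxI.1]
  refine ⟨?_, ?_⟩
  · have h3 : AEStronglyMeasurable v (volume.restrict (Set.Ioc (-1) x)) :=
      hv.aestronglyMeasurable.mono_measure
        (Measure.restrict_mono
        (show Set.Ioc (-1) x ⊆ Set.Icc (-1) 1 from fun t ht => ⟨ht.1.le, ht.2.trans hxI.2⟩) le_rfl)
    simp only [div_eq_mul_inv]
    exact h3.mul (Measurable.aestronglyMeasurable (by fun_prop))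
  · refine (lintegral_Ioc_div_sqrt_le v hxI).trans_lt ?_
    by_contra h
    rw [not_lt, top_le_iff] at h
    rw [h, ENNReal.mul_top (by simp [Real.exp_pos])] at hx
    exact lt_irrefl _ hx

theorem ae_eq_zero_of_add_halfInt_eq_zero {σ : ℝ} (hσ : σ ≠ 0) {v : ℝ → ℝ}
    (hv : Integrable v volI) (h : ∀ᵐ x ∂volI, σ * v x + halfInt v x = 0) :
    ∀ᵐ x ∂volI, v x = 0 := by
  set μ : ℝ := 4 / σ ^ 2 with hμdef
  have hσ2 : 0 < σ ^ 2 := by positivity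
  have hμ : 0 < μ := by positivity
  have hsμ : √μ = 2 / |σ| := by
    rw [hμdef, show 4 / σ ^ 2 = (2 / |σ|) ^ 2 by rw [div_pow, sq_abs]; norm_num,
      Real.sqrt_sq (by positivity)]
  have habs : 0 < |σ| := abs_pos.2 hσ
  have hg : AEMeasurable (fun t => ‖v t‖ₑ) volI := hv.aestronglyMeasurable.enorm
  set Φ := ∫⁻ t, ENNReal.ofReal (Real.exp (-(μ * t))) * ‖v t‖ₑ ∂volI with hΦ
  have hΦt : Φ < ⊤ := lintegral_exp_mul_lt_top μ hv
  have hpt : ∀ᵐ x ∂volI, ENNReal.ofReal (Real.exp (-(μ * x))) * ‖v x‖ₑ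
      ≤ ENNReal.ofReal (1 / (|σ| * √Real.pi)) * (ENNReal.ofReal (Real.exp (-(μ * x)))
        * ∫⁻ t, ‖v t‖ₑ * halfKernel (x - t) ∂volI) := by
    filter_upwards [h, ae_restrict_mem (μ := volume) (s := Set.Icc (-1 : ℝ) 1) measurableSet_Icc]
      with x hx hxI
    have hvx : v x = -(1 / (σ * √Real.pi)) * ∫ t in (-1 : ℝ)..x, v t / √(x - t) := by
      have hp : √Real.pi ≠ 0 := by positivity
      rw [halfInt] at hx
      field_simp
      field_simp at hx
      linarith
    rw [mul_left_comm]
    gcongr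
    rw [hvx, enorm_mul, intervalIntegral.integral_of_le hxI.1]
    refine mul_le_mul' (le_of_eq ?_)
      ((enorm_integral_le_lintegral_enorm _).trans (lintegral_Ioc_div_sqrt_le v hxI))
    rw [enorm_neg, ← ofReal_norm, Real.norm_eq_abs, abs_div, abs_one, abs_mul,
      abs_of_nonneg (Real.sqrt_nonneg _)]
  have hle : Φ ≤ ENNReal.ofReal (1 / 2) * Φ := by
    calc Φ ≤ ∫⁻ x, ENNReal.ofReal (1 / (|σ| * √Real.pi)) * (ENNReal.ofReal (Real.exp (-(μ * x)))
        * ∫⁻ t, ‖v t‖ₑ * halfKernel (x - t) ∂volI) ∂volI := lintegral_mono_ae hpt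
      _ = ENNReal.ofReal (1 / (|σ| * √Real.pi)) * ∫⁻ x, (ENNReal.ofReal (Real.exp (-(μ * x)))
        * ∫⁻ t, ‖v t‖ₑ * halfKernel (x - t) ∂volI) ∂volI :=
          lintegral_const_mul' _ _ ENNReal.ofReal_ne_top
      _ ≤ ENNReal.ofReal (1 / (|σ| * √Real.pi)) * (ENNReal.ofReal (√Real.pi / √μ) * Φ) := by
          gcongr
          exact lintegral_exp_mul_halfKernel_le hμ hg
      _ = ENNReal.ofReal (1 / 2) * Φ := by
          rw [← mul_assoc, ← ENNReal.ofReal_mul (by positivity), hsμ]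
          congr 2
          have hp : √Real.pi ≠ 0 := by positivity
          field_simp
  have hΦ0 : Φ = 0 := by
    lift Φ to NNReal using hΦt.ne with φ
    have h1 : (φ : ENNReal).toReal ≤ (ENNReal.ofReal (1 / 2) * φ).toReal :=
      ENNReal.toReal_mono (ENNReal.mul_ne_top ENNReal.ofReal_ne_top ENNReal.coe_ne_top) hle
    rw [ENNReal.toReal_mul, ENNReal.toReal_ofReal (by norm_num), ENNReal.coe_toReal] at h1
    have h2 : (φ : ℝ) = 0 := le_antisymm (by linarith) φ.2
    exact_mod_cast h2
  have hm : AEMeasurable (fun t => ENNReal.ofReal (Real.exp (-(μ * t))) * ‖v t‖ₑ) volI :=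
    AEMeasurable.mul (by fun_prop) hg
  filter_upwards [(lintegral_eq_zero_iff' hm).1 hΦ0] with x hx
  simpa [(Real.exp_pos _).not_ge] using hx

theorem ae_eq_of_isL2Solution {σ : ℝ} (hσ : σ ≠ 0) {e f : ℕ → ℝ} {u v : ℝ → ℝ}
    (hu : IsL2Solution σ e f u) (hv : IsL2Solution σ e f v) : v =ᵐ[volI] u := by
  have hui := hu.1.integrable (by norm_num)
  have hvi := hv.1.integrable (by norm_num)
  have h := ae_eq_zero_of_add_halfInt_eq_zero hσ (hvi.sub hui) (by
    filter_upwards [hu.2, hv.2, ae_intervalIntegrable_div_sqrt hui,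
      ae_intervalIntegrable_div_sqrt hvi] with x h1 h2 h3 h4
    have h5 : halfInt (v - u) x = halfInt v x - halfInt u x := by
      simp only [halfInt, Pi.sub_apply, sub_div]
      rw [intervalIntegral.integral_sub h4 h3, mul_sub]
    rw [h5, Pi.sub_apply]
    linarith)
  filter_upwards [h] with x hx
  simpa [sub_eq_zero] using hx

/-! ### Half-integrals of Legendre and Chebyshev series -/

lemma matVec_QU_zero (b : ℕ → ℝ) : matVec QU b 0 = √Real.pi / 2 * b 0 := by
  rw [matVec, tsum_eq_single 0]
  · simp [QU]
  · intro n hn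
    simp [QU, hn.symm]

lemma matVec_QU_succ (b : ℕ → ℝ) (k : ℕ) :
    matVec QU b (k + 1) = √Real.pi / 2 * (b (k + 1) + b k) := by
  rw [matVec, tsum_eq_sum (s := {k, k + 1})]
  · rw [Finset.sum_pair (by omega)]
    simp [QU]
    ring
  · intro n hn
    have h1 : k ≠ n ∧ k + 1 ≠ n := by
      simp only [Finset.mem_insert, Finset.mem_singleton, not_or] at hn
      exact ⟨fun h => hn.1 h.symm, fun h => hn.2 h.symm⟩
    simp [QU, h1.1, h1.2]

lemma matVec_QP (a : ℕ → ℝ) (k : ℕ) :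
    matVec QP a k = 2 / (√Real.pi * (2 * k + 1)) * a k
      - 2 / (√Real.pi * (2 * k + 3)) * a (k + 1) := by
  rw [matVec, tsum_eq_sum (s := {k, k + 1})]
  · rw [Finset.sum_pair (by omega)]
    simp [QP]
    ring
  · intro n hn
    have h1 : k ≠ n ∧ k + 1 ≠ n := by
      simp only [Finset.mem_insert, Finset.mem_singleton, not_or] at hn
      exact ⟨fun h => hn.1 h.symm, fun h => hn.2 h.symm⟩
    simp [QP, h1.1, h1.2]

/-- Absolute summability with the weight `(n + 1) ^ 2`. -/
def QuadSummable (a : ℕ → ℝ) : Prop := Summable fun n : ℕ => |a n| * ((n : ℝ) + 1) ^ 2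

lemma QuadSummable.const_mul {a : ℕ → ℝ} (ha : QuadSummable a) (c : ℝ) :
    QuadSummable fun n => c * a n := by
  refine (Summable.mul_left |c| ha).congr fun n => ?_
  rw [abs_mul, mul_assoc]

lemma QuadSummable.of_abs_le {a b : ℕ → ℝ} (ha : QuadSummable a) (h : ∀ n, |b n| ≤ |a n|) :
    QuadSummable b :=
  Summable.of_nonneg_of_le (fun n => by positivity)
    (fun n => mul_le_mul_of_nonneg_right (h n) (by positivity)) ha

lemma QuadSummable.succ {a : ℕ → ℝ} (ha : QuadSummable a) : QuadSummable fun n => a (n + 1) := by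
  refine Summable.of_nonneg_of_le (fun n => by positivity) (fun n => ?_)
    ((summable_nat_add_iff 1).2 ha)
  push_cast
  gcongr
  linarith

section

variable {a b : ℕ → ℝ} {x : ℝ}

lemma abs_mul_legendreP_le (hx : x ∈ Set.Icc (-1 : ℝ) 1) (c : ℝ) (n : ℕ) :
    |c * legendreP n x| ≤ 16 * (|c| * ((n : ℝ) + 1) ^ 2) := by
  rw [abs_mul]
  nlinarith [mul_le_mul_of_nonneg_left (abs_legendreP_le n hx) (abs_nonneg c)]

lemma abs_mul_chebyshevU_le (hx : x ∈ Set.Icc (-1 : ℝ) 1) (c : ℝ) (n : ℕ) :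
    |c * chebyshevU n x| ≤ |c| * ((n : ℝ) + 1) ^ 2 := by
  rw [abs_mul]
  refine mul_le_mul_of_nonneg_left ((abs_chebyshevU_le n hx).trans ?_) (abs_nonneg c)
  nlinarith [(Nat.cast_nonneg n : (0 : ℝ) ≤ n)]

lemma abs_mul_sqrt_mul_chebyshevU_le (hx : x ∈ Set.Icc (-1 : ℝ) 1) (c : ℝ) (n : ℕ) :
    |c * (√(1 + x) * chebyshevU n x)| ≤ 2 * (|c| * ((n : ℝ) + 1) ^ 2) := by
  rw [mul_left_comm, abs_mul, abs_of_nonneg (Real.sqrt_nonneg _)]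
  exact mul_le_mul (sqrt_one_add_le hx) (abs_mul_chebyshevU_le hx c n) (abs_nonneg _) (by norm_num)

lemma QuadSummable.summable_legendreP (ha : QuadSummable a) (hx : x ∈ Set.Icc (-1 : ℝ) 1) :
    Summable fun n => a n * legendreP n x :=
  Summable.of_norm_bounded (Summable.mul_left 16 ha) fun n => abs_mul_legendreP_le hx _ n

lemma QuadSummable.summable_chebyshevU (hb : QuadSummable b) (hx : x ∈ Set.Icc (-1 : ℝ) 1) :
    Summable fun n => b n * chebyshevU n x :=
  Summable.of_norm_bounded hb fun n => abs_mul_chebyshevU_le hx _ n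

lemma QuadSummable.continuousOn_legendreP (ha : QuadSummable a) :
    ContinuousOn (fun x => ∑' n, a n * legendreP n x) (Set.Icc (-1) 1) :=
  continuousOn_tsum (fun n => ((continuous_legendreP n).const_mul (a n)).continuousOn)
    (Summable.mul_left 16 ha) fun n _ hx => abs_mul_legendreP_le hx _ n

lemma QuadSummable.continuousOn_chebyshevU (hb : QuadSummable b) :
    ContinuousOn (fun x => ∑' n, b n * chebyshevU n x) (Set.Icc (-1) 1) :=
  continuousOn_tsum (fun n => ((continuous_chebyshevU n).const_mul (b n)).continuousOn)
    hb fun n _ hx => abs_mul_chebyshevU_le hx _ n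

lemma continuousOn_rhs (ha : QuadSummable a) (hb : QuadSummable b) :
    ContinuousOn (rhs a b) (Set.Icc (-1) 1) :=
  ha.continuousOn_legendreP.add ((by fun_prop : Continuous fun x : ℝ => √(1 + x)).continuousOn.mul
    hb.continuousOn_chebyshevU)

lemma memLp_rhs (ha : QuadSummable a) (hb : QuadSummable b) : MemLp (rhs a b) 2 volI := by
  have hc := continuousOn_rhs ha hb
  obtain ⟨C, hC⟩ := isCompact_Icc.exists_bound_of_continuousOn hc
  refine MemLp.of_bound (hc.aestronglyMeasurable measurableSet_Icc) C ?_
  filter_upwards [ae_restrict_mem (μ := volume) (s := Set.Icc (-1 : ℝ) 1) measurableSet_Icc]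
    with x hx using hC x hx

lemma hasSum_halfInt {u : ℕ → ℝ → ℝ} {B : ℕ → ℝ} (hB : Summable B)
    (hc : ∀ n, Continuous (u n)) (hu : ∀ n, ∀ t ∈ Set.Icc (-1 : ℝ) 1, |u n t| ≤ B n)
    (hx : x ∈ Set.Icc (-1 : ℝ) 1) :
    HasSum (fun n => halfInt (u n) x) (halfInt (fun t => ∑' n, u n t) x) := by
  unfold halfInt
  refine HasSum.mul_left _ ?_
  have hsub : ∀ t ∈ Set.uIoc (-1) x, t ∈ Set.Icc (-1 : ℝ) 1 := by
    intro t ht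
    rw [Set.uIoc_of_le hx.1] at ht
    exact ⟨ht.1.le, ht.2.trans hx.2⟩
  refine intervalIntegral.hasSum_integral_of_dominated_convergence
    (fun n t => B n * (1 / √(x - t))) (fun n => ?_) (fun n => ?_) ?_ ?_ ?_
  · refine Measurable.aestronglyMeasurable ?_
    have := (hc n).measurable
    fun_prop
  · refine Eventually.of_forall fun t ht => ?_
    rw [norm_div, Real.norm_eq_abs, Real.norm_eq_abs, abs_of_nonneg (Real.sqrt_nonneg _),
      div_eq_mul_one_div]
    exact mul_le_mul_of_nonneg_right (hu n t (hsub t ht)) (by positivity)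
  · exact Eventually.of_forall fun t _ => hB.mul_right _
  · simp only [tsum_mul_right]
    exact (intervalIntegrable_inv_sqrt_sub hx.1).const_mul _
  · refine Eventually.of_forall fun t ht => ?_
    have hs : Summable fun n => u n t := Summable.of_norm_bounded hB fun n => hu n t (hsub t ht)
    exact hs.hasSum.div_const _

lemma QuadSummable.matVec_QP (ha : QuadSummable a) : QuadSummable (matVec QP a) := by
  refine Summable.of_nonneg_of_le (fun n => by positivity) (fun n => ?_)
    ((Summable.mul_left 2 ha).add (Summable.mul_left 2 ha.succ))
  rw [HalfIntegral.matVec_QP, ← mul_assoc, ← mul_assoc, ← add_mul]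
  refine mul_le_mul_of_nonneg_right ?_ (by positivity)
  refine (abs_sub _ _).trans (add_le_add ?_ ?_) <;>
  · rw [abs_mul, abs_of_nonneg (by positivity)]
    refine mul_le_mul_of_nonneg_right (div_le_self (by norm_num) ?_) (abs_nonneg _)
    nlinarith [one_le_sqrt_pi, (Nat.cast_nonneg n : (0 : ℝ) ≤ n)]

lemma QuadSummable.add (ha : QuadSummable a) (hb : QuadSummable b) :
    QuadSummable fun n => a n + b n := by
  refine Summable.of_nonneg_of_le (fun n => by positivity) (fun n => ?_) (Summable.add ha hb)
  rw [← add_mul]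
  exact mul_le_mul_of_nonneg_right (abs_add_le _ _) (by positivity)

lemma QuadSummable.of_succ (ha : QuadSummable fun n => a (n + 1)) : QuadSummable a := by
  refine (summable_nat_add_iff 1).1 ?_
  refine Summable.of_nonneg_of_le (fun n => by positivity) (fun n => ?_) (Summable.mul_left 4 ha)
  push_cast
  nlinarith [mul_nonneg (abs_nonneg (a (n + 1))) (by positivity : (0 : ℝ) ≤ 3 * n ^ 2 + 4 * n)]

lemma QuadSummable.matVec_QU (hb : QuadSummable b) : QuadSummable (matVec QU b) := by
  refine QuadSummable.of_succ ?_
  simp only [matVec_QU_succ]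
  exact (hb.succ.add hb).const_mul _

lemma halfInt_tsum_legendreP (ha : QuadSummable a) (hx : x ∈ Set.Icc (-1 : ℝ) 1) :
    halfInt (fun t => ∑' n, a n * legendreP n t) x
      = √(1 + x) * ∑' n, matVec QP a n * chebyshevU n x := by
  have h := (hasSum_halfInt (u := fun n t => a n * legendreP n t) (Summable.mul_left 16 ha)
    (fun n => (continuous_legendreP n).const_mul _)
    (fun n t ht => abs_mul_legendreP_le ht (a n) n) hx).tsum_eq
  rw [← h]
  simp only [halfInt_const_mul, halfInt_legendreP _ hx.1]
  set c : ℕ → ℝ := fun n => 2 / (√Real.pi * (2 * n + 1)) * a n with hc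
  have hcs : QuadSummable c := (ha.const_mul 2).of_abs_le fun n => by
    rw [hc, abs_mul, abs_mul, abs_of_nonneg (by positivity), abs_two]
    refine mul_le_mul_of_nonneg_right (div_le_self (by norm_num) ?_) (abs_nonneg _)
    nlinarith [one_le_sqrt_pi, (Nat.cast_nonneg n : (0 : ℝ) ≤ n)]
  have e1 : ∀ n, a n * (2 / (√Real.pi * (2 * n + 1)) * (√(1 + x) * chebyshevDiff n x))
      = √(1 + x) * (c n * chebyshevDiff n x) := fun n => by
    simp only [hc]
    ring
  have e2 : ∀ n, matVec QP a n * chebyshevU n x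
      = c n * chebyshevU n x - c (n + 1) * chebyshevU n x := fun n => by
    rw [matVec_QP]
    simp only [hc]
    push_cast
    ring
  have s1 := hcs.summable_chebyshevU hx
  have s2 := hcs.succ.summable_chebyshevU hx
  have s3 : Summable fun n => c (n + 1) * chebyshevU (n + 1) x :=
    (summable_nat_add_iff (f := fun n => c n * chebyshevU n x) 1).2 s1
  have e3 : ∀ n, c (n + 1) * chebyshevDiff (n + 1) x
      = c (n + 1) * chebyshevU (n + 1) x - c (n + 1) * chebyshevU n x := fun n => by
    rw [chebyshevDiff]
    ring
  have s4 : Summable fun n => c n * chebyshevDiff n x := by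
    rw [← summable_nat_add_iff 1]
    simp only [e3]
    exact s3.sub s2
  simp only [e1, e2]
  rw [tsum_mul_left, s1.tsum_sub s2, s4.tsum_eq_zero_add, s1.tsum_eq_zero_add]
  simp only [e3]
  rw [s3.tsum_sub s2, chebyshevDiff]
  ring

lemma halfInt_sqrt_mul_tsum_chebyshevU (hb : QuadSummable b) (hx : x ∈ Set.Icc (-1 : ℝ) 1) :
    halfInt (fun t => √(1 + t) * ∑' n, b n * chebyshevU n t) x
      = ∑' n, matVec QU b n * legendreP n x := by
  have h := (hasSum_halfInt (u := fun n t => b n * (√(1 + t) * chebyshevU n t))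
    (Summable.mul_left 2 hb)
    (fun n => by have := continuous_chebyshevU n; fun_prop)
    (fun n t ht => abs_mul_sqrt_mul_chebyshevU_le ht (b n) n) hx).tsum_eq
  have e0 : (fun t => √(1 + t) * ∑' n, b n * chebyshevU n t)
      = fun t => ∑' n, b n * (√(1 + t) * chebyshevU n t) := by
    funext t
    rw [← tsum_mul_left]
    exact tsum_congr fun n => by ring
  rw [e0, ← h]
  simp only [halfInt_const_mul, halfInt_sqrt_mul_chebyshevU _ hx.1]
  set c : ℕ → ℝ := fun n => √Real.pi / 2 * b n with hc
  have hcs : QuadSummable c := hb.const_mul _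
  have e1 : ∀ n, b n * (√Real.pi / 2 * (legendreP n x + legendreP (n + 1) x))
      = c n * legendreP n x + c n * legendreP (n + 1) x := fun n => by
    simp only [hc]
    ring
  have e2 : ∀ n, matVec QU b (n + 1) * legendreP (n + 1) x
      = c (n + 1) * legendreP (n + 1) x + c n * legendreP (n + 1) x := fun n => by
    rw [matVec_QU_succ]
    simp only [hc]
    ring
  have s1 := hcs.summable_legendreP hx
  have s3 : Summable fun n => c (n + 1) * legendreP (n + 1) x :=
    (summable_nat_add_iff (f := fun n => c n * legendreP n x) 1).2 s1
  have s4 := hb.matVec_QU.summable_legendreP hx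
  have s5 : Summable fun n => matVec QU b (n + 1) * legendreP (n + 1) x :=
    (summable_nat_add_iff (f := fun n => matVec QU b n * legendreP n x) 1).2 s4
  have s2 : Summable fun n => c n * legendreP (n + 1) x := by
    refine (s5.sub s3).congr fun n => ?_
    rw [e2]
    ring
  simp only [e1]
  rw [s1.tsum_add s2, s4.tsum_eq_zero_add, s1.tsum_eq_zero_add]
  simp only [e2]
  rw [s3.tsum_add s2, matVec_QU_zero]
  ring

theorem halfInt_rhs (ha : QuadSummable a) (hb : QuadSummable b) (hx : x ∈ Set.Icc (-1 : ℝ) 1) :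
    halfInt (rhs a b) x = rhs (matVec QU b) (matVec QP a) x := by
  have hsub : Set.Icc (-1) x ⊆ Set.Icc (-1 : ℝ) 1 := Set.Icc_subset_Icc le_rfl hx.2
  have h1 := intervalIntegrable_div_sqrt_sub hx.1 (ha.continuousOn_legendreP.mono hsub)
  have h2 := intervalIntegrable_div_sqrt_sub (u := fun t => √(1 + t) * ∑' n, b n * chebyshevU n t)
    hx.1 (((by fun_prop : Continuous fun x : ℝ => √(1 + x)).continuousOn.mul
      hb.continuousOn_chebyshevU).mono hsub)
  rw [rhs, ← halfInt_tsum_legendreP ha hx, ← halfInt_sqrt_mul_tsum_chebyshevU hb hx, add_comm]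
  simp only [halfInt, rhs]
  rw [← mul_add, ← intervalIntegral.integral_add h1 h2]
  congr 2
  funext t
  exact add_div _ _ _

theorem rhs_solves {σ : ℝ} {e f : ℕ → ℝ} (ha : QuadSummable a) (hb : QuadSummable b)
    (h : SolvesSystem σ e f a b) (hx : x ∈ Set.Icc (-1 : ℝ) 1) :
    σ * rhs a b x + halfInt (rhs a b) x = rhs e f x := by
  rw [halfInt_rhs ha hb hx]
  have h1 : e = fun k => σ * a k + matVec QU b k := funext fun k => (h.1 k).symm
  have h2 : f = fun k => matVec QP a k + σ * b k := funext fun k => (h.2 k).symm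
  simp only [rhs]
  rw [h1, h2]
  simp only [add_mul, mul_assoc]
  rw [((ha.summable_legendreP hx).mul_left σ).tsum_add (hb.matVec_QU.summable_legendreP hx),
    (ha.matVec_QP.summable_chebyshevU hx).tsum_add ((hb.summable_chebyshevU hx).mul_left σ),
    tsum_mul_left, tsum_mul_left]
  ring

theorem isL2Solution_rhs {σ : ℝ} {e f : ℕ → ℝ} (ha : QuadSummable a) (hb : QuadSummable b)
    (h : SolvesSystem σ e f a b) : IsL2Solution σ e f (rhs a b) := by
  refine ⟨memLp_rhs ha hb, ?_⟩
  filter_upwards [ae_restrict_mem (μ := volume) (s := Set.Icc (-1 : ℝ) 1) measurableSet_Icc]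
    with x hx using rhs_solves ha hb h hx

/-! ### Injectivity of the block system -/

lemma rhs_one_eq_zero {σ : ℝ} (hσ : σ ≠ 0) (ha : QuadSummable a) (hb : QuadSummable b)
    (h : SolvesSystem σ 0 0 a b) : rhs a b 1 = 0 := by
  have h0 : ∀ x, rhs 0 0 x = 0 := fun x => by simp [rhs]
  have hae := ae_eq_zero_of_add_halfInt_eq_zero hσ ((memLp_rhs ha hb).integrable (by norm_num)) (by
    filter_upwards [(isL2Solution_rhs ha hb h).2] with x hx
    rw [hx, h0])
  have h1 := rhs_solves ha hb h (show (1 : ℝ) ∈ Set.Icc (-1 : ℝ) 1 by simp)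
  have h2 : halfInt (rhs a b) 1 = 0 := by
    rw [halfInt, intervalIntegral.integral_of_le (by norm_num), integral_eq_zero_of_ae, mul_zero]
    have h3 : ∀ᵐ t ∂volume.restrict (Set.Ioc (-1 : ℝ) 1), rhs a b t = 0 :=
      ae_mono (Measure.restrict_mono Set.Ioc_subset_Icc_self le_rfl) hae
    filter_upwards [h3] with t ht
    rw [ht, zero_div, Pi.zero_apply]
  rw [h2, h0, add_zero] at h1
  exact (mul_eq_zero.1 h1).resolve_left hσ

lemma tsum_eq_zero_of_solvesSystem_zero {σ : ℝ} (hσ : σ ≠ 0) (ha : QuadSummable a)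
    (hb : QuadSummable b) (h : SolvesSystem σ 0 0 a b) : ∑' n, a n = 0 := by
  have h1 := rhs_one_eq_zero hσ ha hb h
  have hneg : ∀ k, matVec QU (fun n => -1 * b n) k = - matVec QU b k := by
    intro k
    rw [matVec, matVec, ← tsum_neg]
    exact tsum_congr fun n => by ring
  have h2 := rhs_one_eq_zero (neg_ne_zero.2 hσ) ha (hb.const_mul (-1)) (by
    refine ⟨fun k => ?_, fun k => ?_⟩
    · have := h.1 k
      rw [hneg]
      simp only [Pi.zero_apply] at this ⊢
      linarith
    · have := h.2 k
      simp only [Pi.zero_apply] at this ⊢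
      linarith)
  simp only [rhs, legendreP_one, mul_one] at h1 h2
  have h3 : ∑' n, -1 * b n * chebyshevU n 1 = - ∑' n, b n * chebyshevU n 1 := by
    rw [← tsum_neg]
    exact tsum_congr fun n => by ring
  rw [h3] at h2
  linarith

end

/-- The matrix `QU * QP` of the integration operator in the Legendre basis. -/
def legendreInt (a : ℕ → ℝ) : ℕ → ℝ
  | 0 => a 0 - a 1 / 3
  | k + 1 => a k / (2 * k + 1) - a (k + 2) / (2 * k + 5)

lemma matVec_QU_matVec_QP (a : ℕ → ℝ) (k : ℕ) : matVec QU (matVec QP a) k = legendreInt a k := by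
  have hp : √Real.pi ≠ 0 := by positivity
  cases k with
  | zero =>
    rw [matVec_QU_zero, matVec_QP, legendreInt]
    push_cast
    field_simp
    norm_num
  | succ k =>
    rw [matVec_QU_succ, matVec_QP, matVec_QP, legendreInt]
    push_cast
    have h1 : (2 * (k : ℝ) + 1) ≠ 0 := by positivity
    have h2 : (2 * (k : ℝ) + 3) ≠ 0 := by positivity
    have h4 : (2 * (k : ℝ) + 5) ≠ 0 := by positivity
    have h3 : (2 * ((k : ℝ) + 1) + 1) = 2 * k + 3 := by ring
    have h5 : (2 * ((k : ℝ) + 1) + 3) = 2 * k + 5 := by ring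
    rw [h3, h5]
    field_simp
    ring

lemma matVec_QP_sub (v w : ℕ → ℝ) (k : ℕ) :
    matVec QP (v - w) k = matVec QP v k - matVec QP w k := by
  simp only [matVec_QP, Pi.sub_apply]
  ring

lemma legendreInt_sub (v w : ℕ → ℝ) (k : ℕ) :
    legendreInt (v - w) k = legendreInt v k - legendreInt w k := by
  cases k <;>
  · simp only [legendreInt, Pi.sub_apply]
    ring

lemma matVec_QU_sub (v w : ℕ → ℝ) (k : ℕ) :
    matVec QU (v - w) k = matVec QU v k - matVec QU w k := by
  cases k with
  | zero =>
    simp only [matVec_QU_zero, Pi.sub_apply]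
    ring
  | succ k =>
    simp only [matVec_QU_succ, Pi.sub_apply]
    ring

lemma matVec_QU_congr {b b' : ℕ → ℝ} {k : ℕ} (h : ∀ j ≤ k, b j = b' j) :
    matVec QU b k = matVec QU b' k := by
  cases k with
  | zero => rw [matVec_QU_zero, matVec_QU_zero, h 0 le_rfl]
  | succ k => rw [matVec_QU_succ, matVec_QU_succ, h k (by omega), h (k + 1) le_rfl]

lemma reduced_eq_of_block_eq {σ : ℝ} {e f a b : ℕ → ℝ} {k : ℕ}
    (h1 : σ * a k + matVec QU b k = e k) (h2 : ∀ j ≤ k, matVec QP a j + σ * b j = f j) :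
    σ ^ 2 * a k - legendreInt a k = σ * e k - matVec QU f k := by
  have h3 : matVec QU f k = legendreInt a k + σ * matVec QU b k := by
    rw [← matVec_QU_congr h2, ← matVec_QU_matVec_QP]
    cases k with
    | zero =>
      simp only [matVec_QU_zero]
      ring
    | succ k =>
      simp only [matVec_QU_succ]
      ring
  rw [h3, ← h1]
  ring

/-! ### Injectivity on sequences of polynomial growth -/

lemma natCast_add_one_rpow_le (m : ℝ) (k : ℕ) :
    ((k : ℝ) + 1) ^ m ≤ 2 ^ |m| * ((k : ℝ) + 1 + 1) ^ m
      ∧ ((k : ℝ) + 1 + 1) ^ m ≤ 2 ^ |m| * ((k : ℝ) + 1) ^ m := by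
  have h1 : (0 : ℝ) < (k : ℝ) + 1 := by positivity
  have h2 : (0 : ℝ) < (k : ℝ) + 1 + 1 := by positivity
  have hk : (0 : ℝ) ≤ k := Nat.cast_nonneg k
  have h3 : (1 : ℝ) ≤ 2 ^ |m| := Real.one_le_rpow (by norm_num) (abs_nonneg _)
  rcases le_total 0 m with hm | hm
  · have h4 : ((k : ℝ) + 1) ^ m ≤ ((k : ℝ) + 1 + 1) ^ m :=
      Real.rpow_le_rpow h1.le (by linarith) hm
    refine ⟨h4.trans (le_mul_of_one_le_left (by positivity) h3), ?_⟩
    rw [abs_of_nonneg hm, ← Real.mul_rpow (by norm_num) h1.le]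
    exact Real.rpow_le_rpow h2.le (by linarith) hm
  · have h4 : ((k : ℝ) + 1 + 1) ^ m ≤ ((k : ℝ) + 1) ^ m :=
      Real.rpow_le_rpow_of_nonpos h1 (by linarith) hm
    refine ⟨?_, h4.trans (le_mul_of_one_le_left (by positivity) h3)⟩
    rw [abs_of_nonpos hm, Real.rpow_neg (by norm_num), ← Real.inv_rpow (by norm_num),
      ← Real.mul_rpow (by norm_num) h2.le]
    exact Real.rpow_le_rpow_of_nonpos (by positivity) (by linarith) hm

/-- Polynomial growth of exponent `m`. -/
def PolyGrowth (m : ℝ) (a : ℕ → ℝ) : Prop := ∃ C, ∀ k : ℕ, |a k| ≤ C * ((k : ℝ) + 1) ^ m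

lemma PolyGrowth.legendreInt {m : ℝ} {a : ℕ → ℝ} (h : PolyGrowth m a) :
    PolyGrowth (m - 1) (legendreInt a) := by
  obtain ⟨C, hC⟩ := h
  have hC0 : 0 ≤ C := by
    have := (abs_nonneg _).trans (hC 0)
    simpa using this
  set B : ℝ := 2 ^ |m| with hB
  have hB1 : 1 ≤ B := Real.one_le_rpow (by norm_num) (abs_nonneg _)
  refine ⟨4 * C * B, fun k => ?_⟩
  have hbnd : ∀ j : ℕ, 0 ≤ ((j : ℝ) + 1) ^ m := fun j => by positivity
  rw [Real.rpow_sub_one (by positivity), mul_div_assoc', le_div_iff₀ (by positivity)]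
  cases k with
  | zero =>
    have h0 := hC 0
    have h1 := hC 1
    have h2 := (natCast_add_one_rpow_le m 0).2
    simp only [Nat.cast_zero, Nat.cast_one, zero_add, Real.one_rpow] at h0 h1 h2 ⊢
    rw [HalfIntegral.legendreInt]
    have h3 := abs_sub (a 0) (a 1 / 3)
    rw [abs_div, abs_of_pos (by norm_num : (0 : ℝ) < 3)] at h3
    nlinarith [mul_le_mul_of_nonneg_left h2 hC0, mul_le_mul_of_nonneg_left hB1 hC0, abs_nonneg (a 1)]
  | succ k =>
    have h0 := hC k
    have h1 := hC (k + 2)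
    have h2 := (natCast_add_one_rpow_le m k).1
    have h3 := (natCast_add_one_rpow_le m (k + 1)).2
    have e : ((k + 2 : ℕ) : ℝ) + 1 = k + 1 + 1 + 1 := by push_cast; ring
    rw [e] at h1
    push_cast at h3 ⊢
    rw [HalfIntegral.legendreInt]
    have h4 := abs_sub (a k / (2 * k + 1)) (a (k + 2) / (2 * k + 5))
    have hk : (0 : ℝ) ≤ k := Nat.cast_nonneg k
    rw [abs_div, abs_div, abs_of_pos (by positivity : (0 : ℝ) < 2 * k + 1),
      abs_of_pos (by positivity : (0 : ℝ) < 2 * k + 5)] at h4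
    have h5 : |a k| / (2 * k + 1) * (k + 1 + 1) ≤ 2 * |a k| := by
      rw [div_mul_eq_mul_div, div_le_iff₀ (by positivity)]
      nlinarith [abs_nonneg (a k)]
    have h6 : |a (k + 2)| / (2 * k + 5) * (k + 1 + 1) ≤ 1 * |a (k + 2)| := by
      rw [div_mul_eq_mul_div, div_le_iff₀ (by positivity)]
      nlinarith [abs_nonneg (a (k + 2))]
    calc _ ≤ (|a k| / (2 * k + 1) + |a (k + 2)| / (2 * k + 5)) * ((k : ℝ) + 1 + 1) :=
          mul_le_mul_of_nonneg_right h4 (by positivity)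
      _ ≤ 2 * |a k| + 1 * |a (k + 2)| := by
          rw [add_mul]
          exact add_le_add h5 h6
      _ ≤ 2 * (C * (B * ((k : ℝ) + 1 + 1) ^ m)) + 1 * (C * (B * ((k : ℝ) + 1 + 1) ^ m)) := by
          have := mul_le_mul_of_nonneg_left h2 hC0
          have := mul_le_mul_of_nonneg_left h3 hC0
          linarith
      _ ≤ _ := by
          have : 0 ≤ C * (B * ((k : ℝ) + 1 + 1) ^ m) := by positivity
          nlinarith

lemma PolyGrowth.mono {m m' : ℝ} {a : ℕ → ℝ} (h : PolyGrowth m a) (hm : m ≤ m') :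
    PolyGrowth m' a := by
  obtain ⟨C, hC⟩ := h
  have hC0 : 0 ≤ C := by
    have := (abs_nonneg _).trans (hC 0)
    simpa using this
  refine ⟨C, fun k => (hC k).trans (mul_le_mul_of_nonneg_left
    (Real.rpow_le_rpow_of_exponent_le ?_ hm) hC0)⟩
  linarith [(Nat.cast_nonneg k : (0 : ℝ) ≤ k)]

lemma PolyGrowth.sub {m : ℝ} {a b : ℕ → ℝ} (ha : PolyGrowth m a) (hb : PolyGrowth m b) :
    PolyGrowth m (a - b) := by
  obtain ⟨C, hC⟩ := ha
  obtain ⟨D, hD⟩ := hb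
  refine ⟨C + D, fun k => ?_⟩
  rw [add_mul]
  exact (abs_sub _ _).trans (add_le_add (hC k) (hD k))

lemma PolyGrowth.quadSummable {a : ℕ → ℝ} (h : PolyGrowth (-4) a) : QuadSummable a := by
  obtain ⟨C, hC⟩ := h
  have hs : Summable fun k : ℕ => C * ((k : ℝ) + 1) ^ (-2 : ℝ) := by
    refine Summable.mul_left C ?_
    have := (summable_nat_add_iff 1).2 (Real.summable_nat_rpow.2 (show (-2 : ℝ) < -1 by norm_num))
    simpa using this
  refine Summable.of_nonneg_of_le (fun n => by positivity) (fun n => ?_) hs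
  have h1 : (0 : ℝ) < (n : ℝ) + 1 := by positivity
  calc |a n| * ((n : ℝ) + 1) ^ 2 ≤ C * ((n : ℝ) + 1) ^ (-4 : ℝ) * ((n : ℝ) + 1) ^ 2 :=
        mul_le_mul_of_nonneg_right (hC n) (by positivity)
    _ = C * ((n : ℝ) + 1) ^ (-2 : ℝ) := by
        rw [mul_assoc, ← Real.rpow_natCast, ← Real.rpow_add h1]
        norm_num

lemma PolyGrowth.quadSummable_of_eq {m s : ℝ} (hs : s ≠ 0) {a : ℕ → ℝ} (h : PolyGrowth m a)
    (ha : ∀ k, s * a k = HalfIntegral.legendreInt a k) : QuadSummable a := by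
  have key : ∀ n : ℕ, PolyGrowth (m - n) a := by
    intro n
    induction n with
    | zero => simpa using h
    | succ n ih =>
      obtain ⟨C, hC⟩ := ih.legendreInt
      refine ⟨C / |s|, fun k => ?_⟩
      have hk := hC k
      rw [← ha k, abs_mul] at hk
      rw [div_mul_eq_mul_div, le_div_iff₀ (abs_pos.2 hs)]
      push_cast
      rw [← sub_sub]
      linarith
  obtain ⟨n, hn⟩ := exists_nat_ge (m + 4)
  exact ((key n).mono (by linarith)).quadSummable

lemma pos_of_legendreInt_eq {s : ℝ} (hs : 0 < s) {a : ℕ → ℝ} (hlim : Tendsto a atTop (𝓝 0))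
    (ha : ∀ k, s * a k = legendreInt a k) (h0 : 0 < a 0) (k : ℕ) : 0 < a k := by
  have hrec : ∀ k : ℕ, a (k + 2) / (2 * k + 5) = a k / (2 * k + 1) - s * a (k + 1) := by
    intro k
    rw [ha (k + 1), legendreInt]
    ring
  induction k with
  | zero => exact h0
  | succ k ih =>
    by_contra hneg
    rw [not_lt] at hneg
    have key : ∀ j : ℕ, a k / (2 * k + 1) ≤ a (k + 2 * j) / (2 * (k + 2 * j : ℕ) + 1)
        ∧ a (k + 2 * j + 1) ≤ 0 := by
      intro j
      induction j with
      | zero => exact ⟨le_rfl, hneg⟩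
      | succ j ihj =>
        have e1 : k + 2 * (j + 1) = k + 2 * j + 2 := by ring
        have r1 := hrec (k + 2 * j)
        have r2 := hrec (k + 2 * j + 1)
        rw [show k + 2 * j + 1 + 2 = k + 2 * j + 2 + 1 by ring,
          show k + 2 * j + 1 + 1 = k + 2 * j + 2 by ring] at r2
        rw [e1]
        have p1 : a k / (2 * k + 1) ≤ a (k + 2 * j + 2) / (2 * (k + 2 * j : ℕ) + 5) := by
          rw [r1]
          nlinarith [ihj.1, mul_nonneg hs.le (neg_nonneg.2 ihj.2)]
        have p3 : 0 < a (k + 2 * j + 2) := by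
          have : 0 < a (k + 2 * j + 2) / (2 * (k + 2 * j : ℕ) + 5) :=
            lt_of_lt_of_le (by positivity) p1
          by_contra hc
          exact absurd this (not_lt.2 (div_nonpos_of_nonpos_of_nonneg (not_lt.1 hc)
            (by positivity)))
        refine ⟨?_, ?_⟩
        · convert! p1 using 2
          push_cast
          ring
        · have p4 : a (k + 2 * j + 2 + 1) / (2 * (k + 2 * j + 1 : ℕ) + 5) ≤ 0 := by
            rw [r2]
            have : a (k + 2 * j + 1) / (2 * (k + 2 * j + 1 : ℕ) + 1) ≤ 0 :=
              div_nonpos_of_nonpos_of_nonneg ihj.2 (by positivity)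
            nlinarith [mul_pos hs p3]
          by_contra hc
          exact absurd p4 (not_le.2 (div_pos (not_le.1 hc) (by positivity)))
    have hle : ∀ j : ℕ, a k / (2 * k + 1) ≤ a (k + 2 * j) := by
      intro j
      have h1 := (key j).1
      have h2 : 0 < a k / (2 * k + 1) := by positivity
      rw [le_div_iff₀ (by positivity)] at h1
      refine le_trans ?_ h1
      refine le_mul_of_one_le_right h2.le ?_
      linarith [(Nat.cast_nonneg (k + 2 * j) : (0 : ℝ) ≤ ((k + 2 * j : ℕ) : ℝ))]
    have hsub : Tendsto (fun j : ℕ => a (k + 2 * j)) atTop (𝓝 0) :=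
      hlim.comp (tendsto_atTop_mono (fun j => show j ≤ k + 2 * j by omega) tendsto_id)
    have := ge_of_tendsto' hsub hle
    have h2 : 0 < a k / (2 * k + 1) := by positivity
    linarith

lemma not_pos_of_legendreInt_eq {σ : ℝ} (hσ : σ ≠ 0) {a : ℕ → ℝ} (hq : QuadSummable a)
    (ha : ∀ k, σ ^ 2 * a k = legendreInt a k) : ¬ 0 < a 0 := by
  intro h0
  have hsum : Summable a := by
    have := hq.summable_legendreP (show (1 : ℝ) ∈ Set.Icc (-1 : ℝ) 1 by simp)
    simpa [legendreP_one] using this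
  have hpos := pos_of_legendreInt_eq (by positivity) hsum.tendsto_atTop_zero ha h0
  have hb : QuadSummable fun k => -(1 / σ) * matVec QP a k := hq.matVec_QP.const_mul _
  have hz := tsum_eq_zero_of_solvesSystem_zero hσ hq hb (by
    refine ⟨fun k => ?_, fun k => ?_⟩
    · have h1 : matVec QU (fun k => -(1 / σ) * matVec QP a k) k
          = -(1 / σ) * legendreInt a k := by
        rw [← matVec_QU_matVec_QP, matVec, matVec, ← tsum_mul_left]
        exact tsum_congr fun n => by ring
      rw [h1, ← ha k]
      simp only [Pi.zero_apply]
      field_simp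
      ring
    · simp only [Pi.zero_apply]
      field_simp
      ring)
  exact (hsum.tsum_pos (fun k => (hpos k).le) 0 h0).ne' hz

theorem eq_zero_of_legendreInt_eq {σ m : ℝ} (hσ : σ ≠ 0) {a : ℕ → ℝ} (hm : PolyGrowth m a)
    (ha : ∀ k, σ ^ 2 * a k = legendreInt a k) : a = 0 := by
  have hq := hm.quadSummable_of_eq (by positivity) ha
  have h1 := not_pos_of_legendreInt_eq hσ hq ha
  have h2 := not_pos_of_legendreInt_eq hσ (a := fun k => -1 * a k) (hq.const_mul _) (fun k => by
    have := ha k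
    cases k <;>
    · simp only [legendreInt] at this ⊢
      linear_combination -this)
  have h0 : a 0 = 0 := by linarith
  have hall : ∀ k, a k = 0 ∧ a (k + 1) = 0 := by
    intro k
    induction k with
    | zero =>
      have := ha 0
      simp only [legendreInt, h0] at this
      exact ⟨h0, by linarith⟩
    | succ k ih =>
      have := ha (k + 1)
      simp only [legendreInt, ih.1, ih.2, mul_zero, zero_div, zero_sub] at this
      have h3 : a (k + 2) / (2 * k + 5) = 0 := by linarith
      exact ⟨ih.2, (div_eq_zero_iff.1 h3).resolve_right (by positivity)⟩
  exact funext fun k => (hall k).1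

theorem SolvesSystem.eq_of_polyGrowth {σ m : ℝ} (hσ : σ ≠ 0) {e f a b a' b' : ℕ → ℝ}
    (h : SolvesSystem σ e f a b) (h' : SolvesSystem σ e f a' b')
    (ha : PolyGrowth m a) (ha' : PolyGrowth m a') : a' = a ∧ b' = b := by
  have h1 : a' - a = 0 := by
    refine eq_zero_of_legendreInt_eq hσ (ha'.sub ha) fun k => ?_
    have e1 := reduced_eq_of_block_eq (h.1 k) fun j _ => h.2 j
    have e2 := reduced_eq_of_block_eq (h'.1 k) fun j _ => h'.2 j
    rw [legendreInt_sub, Pi.sub_apply]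
    linarith
  have h2 : a' = a := sub_eq_zero.1 h1
  refine ⟨h2, funext fun k => ?_⟩
  have e1 := h.2 k
  have e2 := h'.2 k
  rw [h2] at e2
  exact mul_left_cancel₀ hσ (by linarith)

section

/-! ### Banded operators on `ℓ²` -/

/-- The Hilbert space of square-summable real sequences. -/
abbrev EllTwo := lp (fun _ : ℕ => ℝ) 2

lemma memℓp_two_iff {v : ℕ → ℝ} : Memℓp v 2 ↔ Summable fun k => v k ^ 2 := by
  rw [memℓp_gen_iff (by norm_num)]
  simp

lemma ellTwo_norm_sq (x : EllTwo) : ‖x‖ ^ 2 = ∑' k, x k ^ 2 := by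
  have := lp.norm_rpow_eq_tsum (p := 2) (by norm_num) x
  simpa using this

lemma ellTwo_summable_sq (x : EllTwo) : Summable fun k => x k ^ 2 := memℓp_two_iff.1 (lp.memℓp x)

lemma sq_le_of_abs_le_neighbours {v g : ℕ → ℝ} {M : ℝ}
    (h : ∀ k, |g k| ≤ M * (|v k| + |v (k + 1)| + |v (k - 1)|)) (k : ℕ) :
    g k ^ 2 ≤ M ^ 2 * (3 * (v k ^ 2 + v (k + 1) ^ 2 + v (k - 1) ^ 2)) := by
  have h1 : g k ^ 2 ≤ (M * (|v k| + |v (k + 1)| + |v (k - 1)|)) ^ 2 := by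
    rw [← sq_abs (g k)]
    exact pow_le_pow_left₀ (abs_nonneg _) (h k) 2
  refine h1.trans ?_
  rw [mul_pow]
  refine mul_le_mul_of_nonneg_left ?_ (sq_nonneg M)
  rw [← sq_abs (v k), ← sq_abs (v (k + 1)), ← sq_abs (v (k - 1))]
  nlinarith [sq_nonneg (|v k| - |v (k + 1)|), sq_nonneg (|v k| - |v (k - 1)|),
    sq_nonneg (|v (k + 1)| - |v (k - 1)|)]

lemma hasSum_neighbours {v : ℕ → ℝ} (hv : Summable fun k => v k ^ 2) (M : ℝ) :
    HasSum (fun k => M ^ 2 * (3 * (v k ^ 2 + v (k + 1) ^ 2 + v (k - 1) ^ 2)))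
      (M ^ 2 * (3 * (3 * ∑' k, v k ^ 2))) := by
  have h2 : Summable fun k => v (k + 1) ^ 2 := (summable_nat_add_iff (f := fun k => v k ^ 2) 1).2 hv
  have h3 : Summable fun k => v (k - 1) ^ 2 := (summable_nat_add_iff 1).1 (by simpa using hv)
  have e2 : ∑' k, v (k + 1) ^ 2 = ∑' k, v k ^ 2 - v 0 ^ 2 := by
    rw [hv.tsum_eq_zero_add]
    ring
  have e3 : ∑' k, v (k - 1) ^ 2 = v 0 ^ 2 + ∑' k, v k ^ 2 := by
    rw [h3.tsum_eq_zero_add]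
    simp
  convert! (((hv.hasSum.add h2.hasSum).add h3.hasSum).mul_left 3).mul_left (M ^ 2) using 3
  rw [e2, e3]
  ring

lemma memℓp_of_abs_le_neighbours {v g : ℕ → ℝ} {M : ℝ} (hv : Memℓp v 2)
    (h : ∀ k, |g k| ≤ M * (|v k| + |v (k + 1)| + |v (k - 1)|)) : Memℓp g 2 :=
  memℓp_two_iff.2 (Summable.of_nonneg_of_le (fun _ => sq_nonneg _) (sq_le_of_abs_le_neighbours h)
    (hasSum_neighbours (memℓp_two_iff.1 hv) M).summable)

lemma norm_le_of_abs_le_neighbours {x y : EllTwo} {M : ℝ} (hM : 0 ≤ M)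
    (h : ∀ k, |y k| ≤ M * (|x k| + |x (k + 1)| + |x (k - 1)|)) : ‖y‖ ≤ 3 * M * ‖x‖ := by
  have h1 := (ellTwo_summable_sq y).tsum_le_tsum (sq_le_of_abs_le_neighbours h)
    (hasSum_neighbours (ellTwo_summable_sq x) M).summable
  rw [(hasSum_neighbours (ellTwo_summable_sq x) M).tsum_eq, ← ellTwo_norm_sq, ← ellTwo_norm_sq] at h1
  refine abs_le_of_sq_le_sq' ?_ (by positivity) |>.2
  linarith

lemma norm_le_of_abs_le {x y : EllTwo} (h : ∀ k, |y k| ≤ |x k|) : ‖y‖ ≤ ‖x‖ := by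
  refine abs_le_of_sq_le_sq' ?_ (norm_nonneg _) |>.2
  rw [ellTwo_norm_sq, ellTwo_norm_sq]
  exact (ellTwo_summable_sq y).tsum_le_tsum (fun k => sq_le_sq.2 (h k)) (ellTwo_summable_sq x)

/-- Truncation of a sequence to the indices below `N`. -/
def head (N : ℕ) (v : ℕ → ℝ) : ℕ → ℝ := fun k => if k < N then v k else 0

lemma abs_head_le (N : ℕ) (v : ℕ → ℝ) (k : ℕ) : |head N v k| ≤ |v k| := by
  unfold head
  split_ifs <;> simp

lemma memℓp_of_abs_le {v g : ℕ → ℝ} (hv : Memℓp v 2) (h : ∀ k, |g k| ≤ |v k|) : Memℓp g 2 :=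
  memℓp_two_iff.2 (Summable.of_nonneg_of_le (fun _ => sq_nonneg _) (fun k => sq_le_sq.2 (h k))
    (memℓp_two_iff.1 hv))

/-- The orthogonal projection of `ℓ²` onto the span of the first `N` unit vectors. -/
def headCLM (N : ℕ) : EllTwo →L[ℝ] EllTwo :=
  LinearMap.mkContinuous
    { toFun := fun x => ⟨head N x, memℓp_of_abs_le (lp.memℓp x) (abs_head_le N x)⟩
      map_add' := fun x y => by
        ext k
        simp only [head, lp.coeFn_add, Pi.add_apply]
        split_ifs <;> simp
      map_smul' := fun c x => by
        ext k
        simp only [head, lp.coeFn_smul, Pi.smul_apply, smul_eq_mul, RingHom.id_apply]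
        split_ifs <;> simp } 1
    (fun x => by
      rw [one_mul]
      exact norm_le_of_abs_le (abs_head_le N x))

lemma headCLM_apply (N : ℕ) (x : EllTwo) (k : ℕ) : headCLM N x k = head N x k := rfl

lemma isCompactOperator_headCLM (N : ℕ) : IsCompactOperator (headCLM N) := by
  induction N with
  | zero =>
    have : headCLM 0 = 0 := by
      ext x k
      simp [headCLM_apply, head]
    rw [this]
    exact isCompactOperator_zero
  | succ N ih =>
    let ev : EllTwo →L[ℝ] ℝ := LinearMap.mkContinuous
      { toFun := fun x => x N
        map_add' := fun x y => rfl
        map_smul' := fun c x => rfl } 1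
      (fun x => by
        rw [one_mul]
        exact lp.norm_apply_le_norm (by norm_num) x N)
    let s : ℝ →L[ℝ] EllTwo := ContinuousLinearMap.toSpanSingleton ℝ (lp.single 2 N (1 : ℝ))
    have hs : IsCompactOperator s := isCompactOperator_of_locallyCompactSpace_rng s
    have h := ih.add (hs.comp_clm ev)
    convert! h using 1
    funext x
    ext k
    change head (N + 1) x k = head N x k + (x N • lp.single 2 N (1 : ℝ) : EllTwo) k
    rw [lp.coeFn_smul, Pi.smul_apply, smul_eq_mul]
    unfold head
    rcases lt_trichotomy k N with hk | rfl | hk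
    · rw [if_pos (by omega), if_pos hk, lp.single_apply_ne _ _ _ hk.ne, mul_zero, add_zero]
    · rw [if_pos (by omega), if_neg (by omega), lp.single_apply_self, mul_one, zero_add]
    · rw [if_neg (by omega), if_neg (by omega), lp.single_apply_ne _ _ _ hk.ne', mul_zero, add_zero]

/-! ### The integration operator in weighted `ℓ²` spaces -/

/-- Positive weights whose consecutive quotients are bounded by `B` and which decay at most
polynomially. -/
structure IsWeight (w : ℕ → ℝ) (B : ℝ) : Prop where
  pos : ∀ k, 0 < w k
  one_le : 1 ≤ B
  le_succ : ∀ k, w k ≤ B * w (k + 1)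
  succ_le : ∀ k, w (k + 1) ≤ B * w k
  polyGrowth_inv : ∃ m, PolyGrowth m fun k => (w k)⁻¹

/-- The integration operator conjugated by multiplication with the weight `w`. -/
def conjInt (w v : ℕ → ℝ) (k : ℕ) : ℝ := w k * legendreInt (fun n => v n / w n) k

variable {w : ℕ → ℝ} {B : ℝ}

lemma IsWeight.mul_div_le (hw : IsWeight w B) {c t : ℝ} {i j : ℕ} (h : w i ≤ B * w j)
    (hc : 0 < c) (y : ℝ) (ht : t ≤ 2 * c) : w i * (|y| / w j / c) * t ≤ 2 * B * |y| := by
  have hj := hw.pos j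
  have h1 : w i * (|y| / w j) ≤ B * |y| := by
    rw [mul_div_assoc', div_le_iff₀ hj]
    nlinarith [mul_le_mul_of_nonneg_right h (abs_nonneg y)]
  have h2 : 0 ≤ B * |y| := mul_nonneg (by linarith [hw.one_le]) (abs_nonneg y)
  have h3 : 0 ≤ w i * (|y| / w j) := mul_nonneg (hw.pos i).le (div_nonneg (abs_nonneg _) hj.le)
  rw [mul_div_assoc', div_mul_eq_mul_div, div_le_iff₀ hc]
  nlinarith [mul_le_mul_of_nonneg_left ht h3]

lemma IsWeight.abs_conjInt_le (hw : IsWeight w B) (v : ℕ → ℝ) (k : ℕ) :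
    |conjInt w v k| ≤ 2 * B / (k + 1) * (|v k| + |v (k + 1)| + |v (k - 1)|) := by
  have hB : 0 ≤ B := by linarith [hw.one_le]
  have habs : ∀ n, |v n / w n| = |v n| / w n := fun n => by
    rw [abs_div, abs_of_pos (hw.pos n)]
  rw [div_mul_eq_mul_div, le_div_iff₀ (by positivity), conjInt, abs_mul, abs_of_pos (hw.pos k)]
  cases k with
  | zero =>
    rw [legendreInt]
    have h1 := abs_sub (v 0 / w 0) (v 1 / w 1 / 3)
    rw [abs_div _ (3 : ℝ), habs, habs, abs_of_pos (by norm_num : (0 : ℝ) < 3)] at h1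
    have h2 := hw.mul_div_le (c := 1) (t := 1) (i := 0) (j := 0)
      (le_mul_of_one_le_left (hw.pos 0).le hw.one_le) one_pos (v 0) (by norm_num)
    have h3 := hw.mul_div_le (c := 3) (t := 1) (hw.le_succ 0) (by norm_num) (v 1) (by norm_num)
    have h4 := mul_le_mul_of_nonneg_left h1 (hw.pos 0).le
    have h5 := mul_nonneg hB (abs_nonneg (v 0))
    simp only [Nat.cast_zero, zero_add, mul_one, div_one] at h2 h3 ⊢
    rw [Nat.zero_sub]
    linarith
  | succ k =>
    rw [legendreInt]
    have hk : (0 : ℝ) ≤ k := Nat.cast_nonneg k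
    have h1 := abs_sub (v k / w k / (2 * k + 1)) (v (k + 2) / w (k + 2) / (2 * k + 5))
    rw [abs_div _ (2 * (k : ℝ) + 1), abs_div _ (2 * (k : ℝ) + 5), habs, habs,
      abs_of_pos (by positivity : (0 : ℝ) < 2 * k + 1),
      abs_of_pos (by positivity : (0 : ℝ) < 2 * k + 5)] at h1
    have h2 := hw.mul_div_le (c := 2 * k + 1) (t := ((k + 1 : ℕ) : ℝ) + 1)
      (hw.succ_le k) (by positivity) (v k) (by push_cast; linarith)
    have h3 := hw.mul_div_le (c := 2 * k + 5) (t := ((k + 1 : ℕ) : ℝ) + 1)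
      (hw.le_succ (k + 1)) (by positivity) (v (k + 2)) (by push_cast; linarith)
    have h4 := mul_le_mul_of_nonneg_right (mul_le_mul_of_nonneg_left h1 (hw.pos (k + 1)).le)
      (by positivity : (0 : ℝ) ≤ ((k + 1 : ℕ) : ℝ) + 1)
    have h5 := mul_nonneg hB (abs_nonneg (v (k + 1)))
    rw [Nat.add_sub_cancel]
    rw [show k + 1 + 1 = k + 2 from rfl] at *
    nlinarith

lemma IsWeight.abs_conjInt_le' (hw : IsWeight w B) (v : ℕ → ℝ) (k : ℕ) :
    |conjInt w v k| ≤ 2 * B * (|v k| + |v (k + 1)| + |v (k - 1)|) := by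
  refine (hw.abs_conjInt_le v k).trans (mul_le_mul_of_nonneg_right ?_ (by positivity))
  have hB : 0 ≤ B := by linarith [hw.one_le]
  exact div_le_self (by positivity) (by linarith [(Nat.cast_nonneg k : (0 : ℝ) ≤ k)])

lemma conjInt_add (u v : ℕ → ℝ) (k : ℕ) : conjInt w (u + v) k = conjInt w u k + conjInt w v k := by
  cases k <;>
  · simp only [conjInt, legendreInt, Pi.add_apply]
    ring

lemma conjInt_smul (c : ℝ) (v : ℕ → ℝ) (k : ℕ) : conjInt w (c • v) k = c * conjInt w v k := by
  cases k <;>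
  · simp only [conjInt, legendreInt, Pi.smul_apply, smul_eq_mul]
    ring

lemma conjInt_sub (u v : ℕ → ℝ) (k : ℕ) : conjInt w (u - v) k = conjInt w u k - conjInt w v k := by
  cases k <;>
  · simp only [conjInt, legendreInt, Pi.sub_apply]
    ring

/-- The weighted integration operator as a bounded operator on `ℓ²`. -/
def IsWeight.conjIntCLM (hw : IsWeight w B) : EllTwo →L[ℝ] EllTwo :=
  LinearMap.mkContinuous
    { toFun := fun x => ⟨conjInt w x, memℓp_of_abs_le_neighbours (lp.memℓp x)
        (hw.abs_conjInt_le' x)⟩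
      map_add' := fun x y => by
        ext k
        exact conjInt_add _ _ k
      map_smul' := fun c x => by
        ext k
        exact conjInt_smul c _ k } (3 * (2 * B))
    (fun x => norm_le_of_abs_le_neighbours (by linarith [hw.one_le]) (hw.abs_conjInt_le' x))

lemma IsWeight.conjIntCLM_apply (hw : IsWeight w B) (x : EllTwo) (k : ℕ) :
    hw.conjIntCLM x k = conjInt w x k := rfl

/-- The finite sections of the weighted integration operator. -/
def IsWeight.sectionCLM (hw : IsWeight w B) (N : ℕ) : EllTwo →L[ℝ] EllTwo :=
  headCLM N * hw.conjIntCLM * headCLM N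

lemma IsWeight.norm_sub_sectionCLM_le (hw : IsWeight w B) (N : ℕ) :
    ‖hw.conjIntCLM - hw.sectionCLM N‖ ≤ 6 * B / (N + 1) * 2 := by
  have hB : 0 ≤ B := by linarith [hw.one_le]
  refine ContinuousLinearMap.opNorm_le_bound _ (by positivity) fun x => ?_
  have h := norm_le_of_abs_le_neighbours (x := x) (y := (hw.conjIntCLM - hw.sectionCLM N) x)
    (M := 4 * B / (N + 1)) (by positivity) (fun k => ?_)
  · refine h.trans (le_of_eq ?_)
    ring
  have e : ((hw.conjIntCLM - hw.sectionCLM N) x) k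
      = conjInt w x k - head N (conjInt w (head N x)) k := rfl
  rw [e]
  have hhead : ∀ j, |x j - head N x j| ≤ |x j| := fun j => by
    unfold head
    split_ifs <;> simp
  have hle : N ≤ k + 1 → 2 * B / ((k : ℝ) + 1) ≤ 4 * B / (N + 1) := fun hk => by
    have hk' : (N : ℝ) ≤ k + 1 := by exact_mod_cast hk
    rw [div_le_div_iff₀ (by positivity) (by positivity)]
    nlinarith [mul_le_mul_of_nonneg_left hk' hB, mul_nonneg hB (Nat.cast_nonneg k : (0 : ℝ) ≤ k)]
  by_cases hk : k < N
  · have e2 : head N (conjInt w (head N x)) k = conjInt w (head N x) k := if_pos hk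
    rw [e2, ← conjInt_sub]
    have hb := hw.abs_conjInt_le ((x : ℕ → ℝ) - head N x) k
    simp only [Pi.sub_apply] at hb
    by_cases hk1 : k + 1 < N
    · have z : ∀ j ≤ k + 1, |x j - head N x j| = 0 := fun j hj => by
        rw [head, if_pos (by omega), sub_self, abs_zero]
      rw [z k (by omega), z (k + 1) le_rfl, z (k - 1) (by omega), add_zero, add_zero,
        mul_zero] at hb
      exact hb.trans (by positivity)
    · refine hb.trans (mul_le_mul (hle (by omega)) ?_ (by positivity) (by positivity))
      exact add_le_add (add_le_add (hhead _) (hhead _)) (hhead _)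
  · have e2 : head N (conjInt w (head N x)) k = 0 := if_neg hk
    rw [e2, sub_zero]
    exact (hw.abs_conjInt_le x k).trans (mul_le_mul_of_nonneg_right (hle (by omega))
      (by positivity))

lemma IsWeight.tendsto_sectionCLM (hw : IsWeight w B) :
    Tendsto hw.sectionCLM atTop (𝓝 hw.conjIntCLM) := by
  rw [tendsto_iff_norm_sub_tendsto_zero]
  have h1 : Tendsto (fun N : ℕ => 6 * B / ((N : ℝ) + 1) * 2) atTop (𝓝 0) := by
    have := (tendsto_one_div_add_atTop_nhds_zero_nat (𝕜 := ℝ)).const_mul (12 * B)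
    rw [mul_zero] at this
    refine this.congr fun N => ?_
    ring
  refine squeeze_zero (fun _ => norm_nonneg _) (fun N => ?_) h1
  rw [norm_sub_rev]
  exact hw.norm_sub_sectionCLM_le N

lemma IsWeight.isCompactOperator (hw : IsWeight w B) : IsCompactOperator hw.conjIntCLM :=
  isCompactOperator_of_tendsto hw.tendsto_sectionCLM (Eventually.of_forall fun N => by
    have h1 := ((isCompactOperator_headCLM N).comp_clm hw.conjIntCLM).comp_clm (headCLM N)
    exact h1)

lemma IsWeight.polyGrowth_div (hw : IsWeight w B) : ∃ m, ∀ v : ℕ → ℝ, Memℓp v 2 →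
    PolyGrowth m fun k => v k / w k := by
  obtain ⟨m, C, hC⟩ := hw.polyGrowth_inv
  refine ⟨m, fun v hv => ⟨‖(⟨v, hv⟩ : EllTwo)‖ * C, fun k => ?_⟩⟩
  have e : |v k / w k| = |v k| * |(w k)⁻¹| := by rw [div_eq_mul_inv, abs_mul]
  rw [mul_assoc]
  refine e.le.trans ?_
  exact mul_le_mul (lp.norm_apply_le_norm (by norm_num) (⟨v, hv⟩ : EllTwo) k) (hC k)
    (abs_nonneg _) (norm_nonneg _)

theorem IsWeight.isUnit_sub (hw : IsWeight w B) {σ : ℝ} (hσ : σ ≠ 0) :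
    IsUnit (algebraMap ℝ (EllTwo →L[ℝ] EllTwo) (σ ^ 2) - hw.conjIntCLM) := by
  have h := hw.isCompactOperator.hasEigenvalue_or_mem_resolventSet (μ := σ ^ 2) (by positivity)
  rcases h with h | h
  · exfalso
    obtain ⟨x, hx⟩ := h.exists_hasEigenvector
    have hx1 : hw.conjIntCLM x = σ ^ 2 • x := hx.apply_eq_smul
    obtain ⟨m, hm⟩ := hw.polyGrowth_div
    have hz := eq_zero_of_legendreInt_eq hσ (hm x (lp.memℓp x)) (fun k => by
      have h1 : conjInt w x k = σ ^ 2 * x k := by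
        rw [← hw.conjIntCLM_apply, hx1]
        rfl
      rw [conjInt] at h1
      have := (hw.pos k).ne'
      rw [mul_div_assoc', ← h1]
      field_simp)
    refine hx.2 ?_
    ext k
    have := congrFun hz k
    simpa [(hw.pos k).ne'] using this
  · exact h

theorem IsWeight.eventually_norm_le (hw : IsWeight w B) {σ : ℝ} (hσ : σ ≠ 0) :
    ∃ C, 0 ≤ C ∧ ∀ᶠ N in atTop, ∀ x : EllTwo, ‖x‖ ≤ C * ‖σ ^ 2 • x - hw.sectionCLM N x‖ := by
  obtain ⟨U, hU⟩ := hw.isUnit_sub hσ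
  set A : ℕ → EllTwo →L[ℝ] EllTwo :=
    fun N => algebraMap ℝ (EllTwo →L[ℝ] EllTwo) (σ ^ 2) - hw.sectionCLM N with hA
  have hlim : Tendsto A atTop (𝓝 (U : EllTwo →L[ℝ] EllTwo)) := by
    rw [hU]
    exact tendsto_const_nhds.sub hw.tendsto_sectionCLM
  have hunit : ∀ᶠ N in atTop, IsUnit (A N) := hlim.eventually (Units.isOpen.mem_nhds U.isUnit)
  have hinv : Tendsto (fun N => ‖Ring.inverse (A N)‖) atTop
      (𝓝 ‖Ring.inverse (U : EllTwo →L[ℝ] EllTwo)‖) :=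
    ((NormedRing.inverse_continuousAt U).tendsto.comp hlim).norm
  refine ⟨‖Ring.inverse (U : EllTwo →L[ℝ] EllTwo)‖ + 1, by positivity, ?_⟩
  filter_upwards [hunit, hinv.eventually (gt_mem_nhds (lt_add_one _))] with N h1 h2 x
  have h3 : x = Ring.inverse (A N) (A N x) := by
    have := congrArg (fun T : EllTwo →L[ℝ] EllTwo => T x) (Ring.inverse_mul_cancel _ h1)
    exact this.symm
  have h4 : A N x = σ ^ 2 • x - hw.sectionCLM N x := by
    rw [hA]
    simp [Algebra.algebraMap_eq_smul_one]
  calc ‖x‖ = ‖Ring.inverse (A N) (A N x)‖ := by rw [← h3]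
    _ ≤ ‖Ring.inverse (A N)‖ * ‖A N x‖ := ContinuousLinearMap.le_opNorm _ _
    _ ≤ _ := by
      rw [← h4]
      exact mul_le_mul_of_nonneg_right h2.le (norm_nonneg _)

end

section

/-! ### Weighted sequence spaces -/

/-- Membership in the `ℓ²` space with weight `w`. -/
def MemW (w v : ℕ → ℝ) : Prop := Memℓp (fun k => w k * v k) 2

/-- The norm of the `ℓ²` space with weight `w`. -/
def wnorm (w v : ℕ → ℝ) : ℝ := √(∑' k, (w k * v k) ^ 2)

variable {w : ℕ → ℝ} {B : ℝ} {u v : ℕ → ℝ}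

/-- A sequence of the weighted space as an element of `ℓ²`. -/
def MemW.toEll (h : MemW w v) : EllTwo := ⟨fun k => w k * v k, h⟩

lemma MemW.toEll_apply (h : MemW w v) (k : ℕ) : h.toEll k = w k * v k := rfl

lemma MemW.norm_toEll (h : MemW w v) : ‖h.toEll‖ = wnorm w v := by
  have h1 := ellTwo_norm_sq h.toEll
  rw [wnorm, ← Real.sqrt_sq (norm_nonneg _), h1]
  rfl

lemma wnorm_nonneg (w v : ℕ → ℝ) : 0 ≤ wnorm w v := Real.sqrt_nonneg _

lemma memW_iff : MemW w v ↔ Summable fun k => (w k * v k) ^ 2 := memℓp_two_iff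

lemma MemW.sub (hu : MemW w u) (hv : MemW w v) : MemW w (u - v) := by
  have e : (fun k => w k * (u - v) k) = (fun k => w k * u k) - fun k => w k * v k :=
    funext fun _ => mul_sub _ _ _
  rw [MemW, e]
  exact Memℓp.sub hu hv

lemma MemW.smul (hv : MemW w v) (c : ℝ) : MemW w (c • v) := by
  have e : (fun k => w k * (c • v) k) = c • fun k => w k * v k :=
    funext fun _ => mul_left_comm _ _ _
  rw [MemW, e]
  exact Memℓp.const_smul hv c

lemma wnorm_sub_le (hu : MemW w u) (hv : MemW w v) :
    wnorm w (u - v) ≤ wnorm w u + wnorm w v := by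
  rw [← (hu.sub hv).norm_toEll, ← hu.norm_toEll, ← hv.norm_toEll]
  have : (hu.sub hv).toEll = hu.toEll - hv.toEll := by
    ext k
    exact mul_sub _ _ _
  rw [this]
  exact norm_sub_le _ _

lemma wnorm_smul (hv : MemW w v) (c : ℝ) : wnorm w (c • v) = |c| * wnorm w v := by
  rw [← (hv.smul c).norm_toEll, ← hv.norm_toEll]
  have : (hv.smul c).toEll = c • hv.toEll := by
    ext k
    exact mul_left_comm _ _ _
  rw [this, norm_smul, Real.norm_eq_abs]

lemma MemW.of_abs_le (hv : MemW w v) (h : ∀ k, |u k| ≤ |v k|) : MemW w u :=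
  memℓp_of_abs_le hv fun k => by
    rw [abs_mul, abs_mul]
    exact mul_le_mul_of_nonneg_left (h k) (abs_nonneg _)

lemma wnorm_le_of_abs_le (hv : MemW w v) (h : ∀ k, |u k| ≤ |v k|) : wnorm w u ≤ wnorm w v := by
  rw [← (hv.of_abs_le h).norm_toEll, ← hv.norm_toEll]
  refine norm_le_of_abs_le fun k => ?_
  rw [MemW.toEll_apply, MemW.toEll_apply, abs_mul, abs_mul]
  exact mul_le_mul_of_nonneg_left (h k) (abs_nonneg _)

lemma memW_of_eq_zero {N : ℕ} (h : ∀ k, N ≤ k → v k = 0) : MemW w v :=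
  memW_iff.2 (summable_of_ne_finset_zero (s := Finset.range N) fun k hk => by
    rw [h k (by simpa using hk), mul_zero]
    norm_num)

/-- The part of a sequence with indices at least `N`. -/
def tail (N : ℕ) (v : ℕ → ℝ) : ℕ → ℝ := fun k => if k < N then 0 else v k

lemma abs_tail_le (N : ℕ) (v : ℕ → ℝ) (k : ℕ) : |tail N v k| ≤ |v k| := by
  unfold tail
  split_ifs <;> simp

lemma tendsto_wnorm_tail (hv : MemW w v) : Tendsto (fun N => wnorm w (tail N v)) atTop (𝓝 0) := by
  have h1 := tendsto_sum_nat_add fun k => (w k * v k) ^ 2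
  have h2 := (Real.continuous_sqrt.tendsto 0).comp h1
  rw [Real.sqrt_zero] at h2
  refine h2.congr fun N => ?_
  have h3 : Summable fun k => (w k * tail N v k) ^ 2 := memW_iff.1 (hv.of_abs_le (abs_tail_le N v))
  rw [wnorm, Function.comp_apply, ← h3.sum_add_tsum_nat_add N, Finset.sum_eq_zero, zero_add]
  · congr 1
    exact tsum_congr fun k => by rw [tail, if_neg (by omega)]
  · intro k hk
    rw [tail, if_pos (by simpa using hk), mul_zero]
    norm_num

lemma wnorm_tail_le {w' : ℕ → ℝ} {N : ℕ} {ε : ℝ} (hw : ∀ k, 0 < w k) (hv : MemW w' v)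
    (hε : 0 ≤ ε) (h : ∀ k, N ≤ k → w k ≤ ε * w' k) : wnorm w (tail N v) ≤ ε * wnorm w' v := by
  have hb : ∀ k, (w k * tail N v k) ^ 2 ≤ ε ^ 2 * (w' k * v k) ^ 2 := by
    intro k
    unfold tail
    split_ifs with hk
    · rw [mul_zero, zero_pow two_ne_zero]
      positivity
    · rw [← mul_pow, ← mul_assoc, mul_pow, mul_pow _ (v k)]
      exact mul_le_mul_of_nonneg_right
        (pow_le_pow_left₀ (hw k).le (h k (not_lt.1 hk)) 2) (sq_nonneg _)
  have hs := (memW_iff.1 hv).mul_left (ε ^ 2)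
  have h1 := (Summable.of_nonneg_of_le (fun _ => sq_nonneg _) hb hs).tsum_le_tsum hb hs
  rw [tsum_mul_left] at h1
  rw [wnorm, wnorm]
  refine (Real.sqrt_le_sqrt h1).trans (le_of_eq ?_)
  rw [Real.sqrt_mul (sq_nonneg _), Real.sqrt_sq hε]

lemma IsWeight.abs_mul_matVec_QP_le (hw : IsWeight w B) (a : ℕ → ℝ) (k : ℕ) :
    |w k * matVec QP a k|
      ≤ 2 * B * (|w k * a k| + |w (k + 1) * a (k + 1)| + |w (k - 1) * a (k - 1)|) := by
  have hk : (0 : ℝ) ≤ k := Nat.cast_nonneg k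
  have h0 := hw.one_le
  have h1 : |matVec QP a k| ≤ 2 * |a k| + 2 * |a (k + 1)| := by
    rw [matVec_QP]
    refine (abs_sub _ _).trans (add_le_add ?_ ?_) <;>
    · rw [abs_mul, abs_of_nonneg (by positivity)]
      refine mul_le_mul_of_nonneg_right (div_le_self (by norm_num) ?_) (abs_nonneg _)
      nlinarith [one_le_sqrt_pi]
  simp only [abs_mul, abs_of_pos (hw.pos _)]
  have h2 := mul_le_mul_of_nonneg_left h1 (hw.pos k).le
  have h3 := mul_le_mul_of_nonneg_right (hw.le_succ k) (abs_nonneg (a (k + 1)))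
  have h4 : w k * |a k| ≤ B * (w k * |a k|) :=
    le_mul_of_one_le_left (mul_nonneg (hw.pos k).le (abs_nonneg _)) h0
  have h5 : 0 ≤ B * (w (k - 1) * |a (k - 1)|) :=
    mul_nonneg (by linarith) (mul_nonneg (hw.pos _).le (abs_nonneg _))
  nlinarith

lemma IsWeight.memW_matVec_QP (hw : IsWeight w B) (hv : MemW w v) : MemW w (matVec QP v) :=
  memℓp_of_abs_le_neighbours hv (hw.abs_mul_matVec_QP_le v)

lemma IsWeight.wnorm_matVec_QP_le (hw : IsWeight w B) (hv : MemW w v) :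
    wnorm w (matVec QP v) ≤ 6 * B * wnorm w v := by
  rw [← (hw.memW_matVec_QP hv).norm_toEll, ← hv.norm_toEll]
  refine (norm_le_of_abs_le_neighbours (x := hv.toEll) (M := 2 * B) (by linarith [hw.one_le])
    (hw.abs_mul_matVec_QP_le v)).trans (le_of_eq ?_)
  ring

lemma IsWeight.memW_matVec_QU (hw : IsWeight w B) (hv : MemW w v) : MemW w (matVec QU v) := by
  refine memℓp_of_abs_le_neighbours (M := 2 * B) hv fun k => ?_
  have hp : √Real.pi / 2 ≤ 2 := by
    have : √Real.pi ≤ 4 := Real.sqrt_le_iff.2 ⟨by norm_num, by linarith [Real.pi_lt_four]⟩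
    linarith
  have hp0 : 0 ≤ √Real.pi / 2 := by positivity
  have h0 := hw.one_le
  have hnn : ∀ j, 0 ≤ w j * |v j| := fun j => mul_nonneg (hw.pos j).le (abs_nonneg _)
  have hBn : ∀ j, 0 ≤ B * (w j * |v j|) := fun j => mul_nonneg (by linarith) (hnn j)
  cases k with
  | zero =>
    rw [matVec_QU_zero]
    simp only [abs_mul, abs_of_pos (hw.pos _), abs_of_nonneg hp0, Nat.zero_sub]
    have h1 := mul_le_mul_of_nonneg_right hp (hnn 0)
    have h2 : w 0 * |v 0| ≤ B * (w 0 * |v 0|) := le_mul_of_one_le_left (hnn 0) h0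
    nlinarith [hBn 0, hBn 1]
  | succ k =>
    rw [matVec_QU_succ, Nat.add_sub_cancel]
    have h1 : |√Real.pi / 2 * (v (k + 1) + v k)| ≤ 2 * (|v (k + 1)| + |v k|) := by
      rw [abs_mul, abs_of_nonneg hp0]
      exact mul_le_mul hp (abs_add_le _ _) (abs_nonneg _) (by norm_num)
    rw [abs_mul]
    simp only [abs_mul (w _) (v _), abs_of_pos (hw.pos _)]
    have h2 := mul_le_mul_of_nonneg_left h1 (hw.pos (k + 1)).le
    have h3 := mul_le_mul_of_nonneg_right (hw.succ_le k) (abs_nonneg (v k))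
    have h4 : w (k + 1) * |v (k + 1)| ≤ B * (w (k + 1) * |v (k + 1)|) :=
      le_mul_of_one_le_left (hnn _) h0
    nlinarith [hBn (k + 1 + 1)]

lemma IsWeight.polyGrowth (hw : IsWeight w B) : ∃ m, ∀ v, MemW w v → PolyGrowth m v := by
  obtain ⟨m, hm⟩ := hw.polyGrowth_div
  refine ⟨m, fun v hv => ?_⟩
  have := hm _ hv
  convert! this using 1
  funext k
  have := (hw.pos k).ne'
  field_simp

lemma IsWeight.conjInt_mul (hw : IsWeight w B) (v : ℕ → ℝ) (k : ℕ) :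
    conjInt w (fun n => w n * v n) k = w k * legendreInt v k := by
  rw [conjInt]
  congr 2
  funext n
  have := (hw.pos n).ne'
  field_simp

/-! ### Solvability and the error of the finite sections -/

theorem IsWeight.exists_solvesSystem (hw : IsWeight w B) {σ : ℝ} (hσ : σ ≠ 0) {e f : ℕ → ℝ}
    (he : MemW w e) (hf : MemW w f) :
    ∃ a b, MemW w a ∧ MemW w b ∧ SolvesSystem σ e f a b := by
  have hh : MemW w (σ • e - matVec QU f) := (he.smul σ).sub (hw.memW_matVec_QU hf)
  obtain ⟨x, hx⟩ := (ContinuousLinearMap.isUnit_iff_bijective.1 (hw.isUnit_sub hσ)).2 hh.toEll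
  set a : ℕ → ℝ := fun k => x k / w k with ha
  have hwa : ∀ k, w k * a k = x k := fun k => mul_div_cancel₀ _ (hw.pos k).ne'
  have haW : MemW w a := by
    have := lp.memℓp x
    unfold MemW
    convert! this using 1
    exact funext hwa
  have hred : ∀ k, σ ^ 2 * a k - legendreInt a k = σ * e k - matVec QU f k := by
    intro k
    have h1 : ((algebraMap ℝ (EllTwo →L[ℝ] EllTwo) (σ ^ 2) - hw.conjIntCLM) x) k
        = σ ^ 2 * x k - conjInt w x k := by
      rw [Algebra.algebraMap_eq_smul_one]
      rfl
    rw [hx, hh.toEll_apply] at h1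
    have h2 : conjInt w x k = w k * legendreInt a k := rfl
    rw [h2, ← hwa k] at h1
    simp only [Pi.sub_apply, Pi.smul_apply, smul_eq_mul] at h1
    exact mul_left_cancel₀ (hw.pos k).ne' (by linarith)
  refine ⟨a, σ⁻¹ • (f - matVec QP a), haW, (hf.sub (hw.memW_matVec_QP haW)).smul _, ?_, ?_⟩
  · intro k
    have h1 : matVec QU (σ⁻¹ • (f - matVec QP a)) k
        = σ⁻¹ * (matVec QU f k - legendreInt a k) := by
      rw [← matVec_QU_matVec_QP, ← matVec_QU_sub, matVec, matVec, ← tsum_mul_left]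
      exact tsum_congr fun n => by simp only [Pi.smul_apply, smul_eq_mul]; ring
    rw [h1]
    have := hred k
    field_simp
    linarith
  · intro k
    simp only [Pi.smul_apply, Pi.sub_apply, smul_eq_mul]
    field_simp
    ring

theorem IsWeight.section_error (hw : IsWeight w B) {σ : ℝ} (hσ : σ ≠ 0) :
    ∃ C, 0 ≤ C ∧ ∀ᶠ N in atTop, ∀ a x : ℕ → ℝ, MemW w a → (∀ k, N ≤ k → x k = 0) →
      (∀ k < N, σ ^ 2 * x k - legendreInt x k = σ ^ 2 * a k - legendreInt a k) →
      wnorm w (x - a) ≤ C * wnorm w (tail N a) := by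
  obtain ⟨C, hC0, hC⟩ := hw.eventually_norm_le hσ
  have hB := hw.one_le
  refine ⟨C * (6 * B) + 1, by positivity, ?_⟩
  filter_upwards [hC] with N hN a x ha hx heq
  have hxW : MemW w x := memW_of_eq_zero hx
  have htW : MemW w (tail N a) := ha.of_abs_le (abs_tail_le N a)
  have hdW := hxW.sub (ha.sub htW)
  have h1 := hN hdW.toEll
  have hs : ∀ k, N ≤ k → (x - (a - tail N a)) k = 0 := fun k hk => by
    simp [tail, hx k hk, not_lt.2 hk]
  have h2 : ‖σ ^ 2 • hdW.toEll - hw.sectionCLM N hdW.toEll‖ ≤ ‖hw.conjIntCLM htW.toEll‖ := by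
    refine norm_le_of_abs_le fun k => ?_
    have e1 : (σ ^ 2 • hdW.toEll - hw.sectionCLM N hdW.toEll) k
        = σ ^ 2 * (w k * (x - (a - tail N a)) k)
          - head N (conjInt w (head N (fun n => w n * (x - (a - tail N a)) n))) k := rfl
    have e2 : hw.conjIntCLM htW.toEll k = w k * legendreInt (tail N a) k :=
      hw.conjInt_mul (tail N a) k
    have e3 : head N (fun n => w n * (x - (a - tail N a)) n)
        = fun n => w n * (x - (a - tail N a)) n := by
      funext n
      unfold head
      split_ifs with hn
      · rfl
      · rw [hs n (not_lt.1 hn), mul_zero]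
    rw [e1, e2, e3]
    unfold head
    split_ifs with hk
    · rw [hw.conjInt_mul]
      have h3 := heq k hk
      have h4 : tail N a k = 0 := if_pos hk
      rw [legendreInt_sub, legendreInt_sub]
      simp only [Pi.sub_apply, h4]
      rw [← abs_neg]
      refine le_of_eq (congrArg abs ?_)
      linear_combination (-w k) * h3
    · rw [hs k (not_lt.1 hk), mul_zero, mul_zero, sub_zero, abs_zero]
      exact abs_nonneg _
  have h3 : ‖hw.conjIntCLM htW.toEll‖ ≤ 6 * B * wnorm w (tail N a) := by
    rw [← htW.norm_toEll]
    refine (norm_le_of_abs_le_neighbours (M := 2 * B) (by linarith)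
      (hw.abs_conjInt_le' _)).trans (le_of_eq ?_)
    ring
  rw [hdW.norm_toEll] at h1
  have h4 : x - a = (x - (a - tail N a)) - tail N a := by
    funext k
    simp only [Pi.sub_apply]
    ring
  rw [h4]
  refine (wnorm_sub_le hdW htW).trans ?_
  have := mul_le_mul_of_nonneg_left (h2.trans h3) hC0
  linarith

/-! ### The finite sections of the block system -/

/-- Extension of a finite vector by zero. -/
def extend (N : ℕ) (z : Fin N → ℝ) (k : ℕ) : ℝ := if h : k < N then z ⟨k, h⟩ else 0

lemma extend_of_le {N k : ℕ} (z : Fin N → ℝ) (h : N ≤ k) : extend N z k = 0 :=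
  dif_neg (not_lt.2 h)

lemma extend_fin {N : ℕ} (z : Fin N → ℝ) (i : Fin N) : extend N z i = z i := dif_pos i.2

lemma finSection_mulVec {N : ℕ} (A : Matrix ℕ ℕ ℝ) (z : Fin N → ℝ) (i : Fin N) :
    (finSection N A).mulVec z i = matVec A (extend N z) i := by
  rw [matVec, tsum_eq_sum (s := Finset.range N), ← Fin.sum_univ_eq_sum_range
    (fun n => A i n * extend N z n)]
  · simp only [extend_fin]
    rfl
  · intro n hn
    rw [extend_of_le z (by simpa using hn), mul_zero]

lemma blockSection_mulVec_inl (σ : ℝ) {N : ℕ} (z : Fin N ⊕ Fin N → ℝ) (i : Fin N) :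
    (blockSection σ N).mulVec z (Sum.inl i)
      = σ * extend N (z ∘ Sum.inl) i + matVec QU (extend N (z ∘ Sum.inr)) i := by
  rw [blockSection, Matrix.fromBlocks_mulVec, Sum.elim_inl, Pi.add_apply, finSection_mulVec,
    Matrix.smul_mulVec, Matrix.one_mulVec, extend_fin]
  rfl

lemma blockSection_mulVec_inr (σ : ℝ) {N : ℕ} (z : Fin N ⊕ Fin N → ℝ) (i : Fin N) :
    (blockSection σ N).mulVec z (Sum.inr i)
      = matVec QP (extend N (z ∘ Sum.inl)) i + σ * extend N (z ∘ Sum.inr) i := by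
  rw [blockSection, Matrix.fromBlocks_mulVec, Sum.elim_inr, Pi.add_apply, finSection_mulVec,
    Matrix.smul_mulVec, Matrix.one_mulVec, extend_fin]
  rfl

lemma isWeight_one : IsWeight (fun _ => 1) 1 where
  pos _ := one_pos
  one_le := le_rfl
  le_succ _ := by norm_num
  succ_le _ := by norm_num
  polyGrowth_inv := ⟨0, 1, fun k => by simp⟩

theorem eventually_isUnit_blockSection {σ : ℝ} (hσ : σ ≠ 0) :
    ∀ᶠ N : ℕ in atTop, IsUnit (blockSection σ N) := by
  obtain ⟨C, -, hC⟩ := isWeight_one.section_error hσ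
  filter_upwards [hC] with N hN
  rw [← Matrix.mulVec_injective_iff_isUnit]
  intro z₁ z₂ hz
  obtain ⟨z, hz'⟩ : ∃ z, z = z₁ - z₂ := ⟨_, rfl⟩
  have hz0 : (blockSection σ N).mulVec z = 0 := by
    rw [hz', Matrix.mulVec_sub]
    exact sub_eq_zero.2 hz
  set a := extend N (z ∘ Sum.inl) with ha
  set b := extend N (z ∘ Sum.inr) with hb
  have h1 : ∀ k < N, σ * a k + matVec QU b k = 0 := fun k hk => by
    have := congrFun hz0 (Sum.inl ⟨k, hk⟩)
    rwa [blockSection_mulVec_inl] at this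
  have h2 : ∀ k < N, matVec QP a k + σ * b k = 0 := fun k hk => by
    have := congrFun hz0 (Sum.inr ⟨k, hk⟩)
    rwa [blockSection_mulVec_inr] at this
  have hz1 : MemW (fun _ => 1) 0 := memW_of_eq_zero (N := 0) fun _ _ => rfl
  have h3 := hN 0 a hz1 (fun k hk => extend_of_le _ hk) (fun k hk => by
    rw [reduced_eq_of_block_eq (e := 0) (f := 0) (h1 k hk) fun j hj => h2 j (by omega),
      reduced_eq_of_block_eq (e := 0) (f := 0) (a := 0) (b := 0)] <;> simp [matVec])
  have h4 : tail N 0 = 0 := by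
    funext k
    simp [tail]
  have haW : MemW (fun _ => 1) (a - 0) :=
    (memW_of_eq_zero fun k hk => extend_of_le _ hk).sub hz1
  have h5 : wnorm (fun _ => 1) (a - 0) ≤ 0 := by
    refine h3.trans (le_of_eq ?_)
    rw [h4]
    simp [wnorm]
  rw [← haW.norm_toEll, norm_le_zero_iff] at h5
  have ha0 : a = 0 := funext fun k => by
    have : haW.toEll k = 0 := by rw [h5]; rfl
    simpa [MemW.toEll_apply] using this
  have hz2 : z = 0 := by
    funext i
    rcases i with i | i
    · have := congrFun ha0 i
      rwa [ha, extend_fin] at this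
    · have := h2 i i.2
      rw [ha0, hb, extend_fin] at this
      have hq : matVec QP 0 i = 0 := by simp [matVec]
      rw [hq, zero_add] at this
      exact (mul_eq_zero.1 this).resolve_left hσ
  exact sub_eq_zero.1 (hz'.symm.trans hz2)

lemma aN_eq_extend (σ : ℝ) (e f : ℕ → ℝ) (N : ℕ) :
    aN σ e f N = extend N (blockSol σ e f N ∘ Sum.inl) := rfl

lemma bN_eq_extend (σ : ℝ) (e f : ℕ → ℝ) (N : ℕ) :
    bN σ e f N = extend N (blockSol σ e f N ∘ Sum.inr) := rfl

lemma blockSection_mulVec_blockSol {σ : ℝ} (e f : ℕ → ℝ) {N : ℕ} (h : IsUnit (blockSection σ N)) :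
    (blockSection σ N).mulVec (blockSol σ e f N)
      = Sum.elim (fun i : Fin N => e i) (fun i : Fin N => f i) := by
  rw [blockSol, Matrix.mulVec_mulVec, Matrix.mul_nonsing_inv _
    ((Matrix.isUnit_iff_isUnit_det _).1 h), Matrix.one_mulVec]

theorem IsWeight.finSection_error (hw : IsWeight w B) {σ : ℝ} (hσ : σ ≠ 0) :
    ∃ C, 0 ≤ C ∧ ∀ᶠ N in atTop, ∀ e f a b : ℕ → ℝ, MemW w a → MemW w b → SolvesSystem σ e f a b →
      wnorm w (aN σ e f N - a) ≤ C * (wnorm w (tail N a) + wnorm w (tail N b)) ∧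
      wnorm w (bN σ e f N - b) ≤ C * (wnorm w (tail N a) + wnorm w (tail N b)) := by
  obtain ⟨C, hC0, hC⟩ := hw.section_error hσ
  have hB := hw.one_le
  have hσ' : 0 < |σ| := abs_pos.2 hσ
  have hσi : |σ⁻¹| = |σ|⁻¹ := abs_inv σ
  refine ⟨C + |σ|⁻¹ * (6 * B) * C + 1, by positivity, ?_⟩
  filter_upwards [hC, eventually_isUnit_blockSection hσ] with N hN hunit e f a b ha hb hab
  have hsol := blockSection_mulVec_blockSol e f hunit
  have h1 : ∀ k < N, σ * aN σ e f N k + matVec QU (bN σ e f N) k = e k := fun k hk => by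
    have := congrFun hsol (Sum.inl ⟨k, hk⟩)
    rwa [blockSection_mulVec_inl] at this
  have h2 : ∀ k < N, matVec QP (aN σ e f N) k + σ * bN σ e f N k = f k := fun k hk => by
    have := congrFun hsol (Sum.inr ⟨k, hk⟩)
    rwa [blockSection_mulVec_inr] at this
  have h3 := hN a (aN σ e f N) ha (fun k hk => by rw [aN_eq_extend, extend_of_le _ hk])
    (fun k hk => by
      rw [reduced_eq_of_block_eq (h1 k hk) fun j hj => h2 j (by omega),
        reduced_eq_of_block_eq (hab.1 k) fun j _ => hab.2 j])
  have haW : MemW w (aN σ e f N) := memW_of_eq_zero fun k hk => by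
    rw [aN_eq_extend, extend_of_le _ hk]
  have hta := wnorm_nonneg w (tail N a)
  have htb := wnorm_nonneg w (tail N b)
  have hd : MemW w (aN σ e f N - a) := haW.sub ha
  have hq := hw.memW_matVec_QP hd
  have htW : MemW w (tail N b) := hb.of_abs_le (abs_tail_le N b)
  set D : ℕ → ℝ := head N (matVec QP (aN σ e f N - a)) with hD
  have hDW : MemW w D := hq.of_abs_le (abs_head_le N _)
  have hbd : bN σ e f N - b = (-σ⁻¹) • D - tail N b := by
    funext k
    simp only [Pi.sub_apply, Pi.smul_apply, smul_eq_mul, hD, head, tail]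
    split_ifs with hk
    · have e1 := h2 k hk
      have e2 := hab.2 k
      rw [matVec_QP_sub]
      field_simp
      linarith
    · rw [bN_eq_extend, extend_of_le _ (not_lt.1 hk)]
      ring
  have h4 : wnorm w D ≤ 6 * B * wnorm w (aN σ e f N - a) :=
    (wnorm_le_of_abs_le hq (abs_head_le N _)).trans (hw.wnorm_matVec_QP_le hd)
  have h5 : wnorm w (bN σ e f N - b) ≤ |σ|⁻¹ * wnorm w D + wnorm w (tail N b) := by
    rw [hbd]
    refine (wnorm_sub_le (hDW.smul _) htW).trans (le_of_eq ?_)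
    rw [wnorm_smul hDW, abs_neg, hσi]
  have h6 : |σ|⁻¹ * wnorm w D ≤ |σ|⁻¹ * (6 * B) * C * wnorm w (tail N a) := by
    have := mul_le_mul_of_nonneg_left (h4.trans (mul_le_mul_of_nonneg_left h3
      (by linarith : 0 ≤ 6 * B))) (inv_nonneg.2 hσ'.le)
    linarith
  have hE : 0 ≤ |σ|⁻¹ * (6 * B) * C := by positivity
  constructor <;>
    nlinarith [mul_nonneg hE hta, mul_nonneg hE htb, mul_nonneg hC0 hta, mul_nonneg hC0 htb]

end

section

/-! ### Polynomial and exponential weights -/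

lemma isWeight_rpow (lam : ℝ) : IsWeight (fun k : ℕ => ((k : ℝ) + 1) ^ lam) (2 ^ |lam|) where
  pos k := by positivity
  one_le := Real.one_le_rpow (by norm_num) (abs_nonneg _)
  le_succ k := by
    have := (natCast_add_one_rpow_le lam k).1
    push_cast
    exact this
  succ_le k := by
    have := (natCast_add_one_rpow_le lam k).2
    push_cast
    exact this
  polyGrowth_inv := ⟨-lam, 1, fun k => by
    rw [Real.rpow_neg (by positivity), one_mul, abs_of_nonneg (by positivity)]⟩

lemma isWeight_pow {c : ℝ} (hc : 1 ≤ c) : IsWeight (fun k : ℕ => c ^ k) c where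
  pos k := by positivity
  one_le := hc
  le_succ k := by
    have h1 : c ^ k ≤ c ^ (k + 1) := pow_le_pow_right₀ hc (Nat.le_succ k)
    exact h1.trans (le_mul_of_one_le_left (by positivity) hc)
  succ_le k := (pow_succ' c k).le
  polyGrowth_inv := ⟨0, 1, fun k => by
    rw [Real.rpow_zero, one_mul, abs_of_nonneg (by positivity)]
    exact inv_le_one_of_one_le₀ (one_le_pow₀ hc)⟩

lemma rpow_mul_sq (lam : ℝ) (v : ℕ → ℝ) (k : ℕ) :
    ((k : ℝ) + 1) ^ (2 * lam) * v k ^ 2 = (((k : ℝ) + 1) ^ lam * v k) ^ 2 := by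
  rw [mul_pow, ← Real.rpow_mul_natCast (by positivity), mul_comm lam]
  norm_num

lemma memEll_iff {lam : ℝ} {v : ℕ → ℝ} :
    MemEll lam v ↔ MemW (fun k : ℕ => ((k : ℝ) + 1) ^ lam) v := by
  rw [memW_iff, MemEll]
  simp only [rpow_mul_sq]

lemma ellNorm_eq (lam : ℝ) (v : ℕ → ℝ) :
    ellNorm lam v = wnorm (fun k : ℕ => ((k : ℝ) + 1) ^ lam) v := by
  rw [ellNorm, wnorm]
  simp only [rpow_mul_sq]

/-! ### Error bounds in `L²` -/

variable {w W : ℕ → ℝ} {B B' : ℝ} {a b : ℕ → ℝ}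

lemma MemW.mono (hw : ∀ k, 0 < w k) (h : ∀ k, w k ≤ W k) (ha : MemW W a) : MemW w a :=
  memℓp_of_abs_le ha fun k => by
    rw [abs_mul, abs_mul, abs_of_pos (hw k)]
    exact mul_le_mul_of_nonneg_right ((h k).trans (le_abs_self _)) (abs_nonneg _)

lemma MemW.abs_mul_sq_le (hw : ∀ k, 0 < w k) (ha : MemW w a) (k : ℕ) :
    |a k| * ((k : ℝ) + 1) ^ 2 ≤ wnorm w a * (((k : ℝ) + 1) ^ 2 / w k) := by
  have h1 := lp.norm_apply_le_norm (by norm_num) ha.toEll k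
  rw [ha.norm_toEll, ha.toEll_apply, Real.norm_eq_abs, abs_mul, abs_of_pos (hw k)] at h1
  rw [mul_div_assoc', le_div_iff₀ (hw k)]
  nlinarith [mul_le_mul_of_nonneg_right h1 (sq_nonneg ((k : ℝ) + 1))]

lemma MemW.quadSummable (hw : ∀ k, 0 < w k)
    (hS : Summable fun k : ℕ => ((k : ℝ) + 1) ^ 2 / w k) (ha : MemW w a) : QuadSummable a :=
  Summable.of_nonneg_of_le (fun k => by positivity) (ha.abs_mul_sq_le hw) (hS.mul_left _)

lemma MemW.tsum_abs_mul_sq_le (hw : ∀ k, 0 < w k)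
    (hS : Summable fun k : ℕ => ((k : ℝ) + 1) ^ 2 / w k) (ha : MemW w a) :
    ∑' k : ℕ, |a k| * ((k : ℝ) + 1) ^ 2 ≤ wnorm w a * ∑' k : ℕ, ((k : ℝ) + 1) ^ 2 / w k := by
  rw [← tsum_mul_left]
  exact (ha.quadSummable hw hS).tsum_le_tsum (ha.abs_mul_sq_le hw) (hS.mul_left _)

lemma QuadSummable.polyGrowth (ha : QuadSummable a) : PolyGrowth 0 a := by
  refine ⟨∑' k : ℕ, |a k| * ((k : ℝ) + 1) ^ 2, fun k => ?_⟩
  rw [Real.rpow_zero, mul_one]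
  refine le_trans ?_ (ha.le_tsum k fun j _ => by positivity)
  refine le_mul_of_one_le_right (abs_nonneg _) ?_
  nlinarith [(Nat.cast_nonneg k : (0 : ℝ) ≤ k)]

lemma abs_rhs_le (ha : QuadSummable a) (hb : QuadSummable b) {x : ℝ}
    (hx : x ∈ Set.Icc (-1 : ℝ) 1) :
    |rhs a b x| ≤ 16 * ∑' k : ℕ, |a k| * ((k : ℝ) + 1) ^ 2
      + 2 * ∑' k : ℕ, |b k| * ((k : ℝ) + 1) ^ 2 := by
  have h1 : |∑' n, a n * legendreP n x| ≤ 16 * ∑' k : ℕ, |a k| * ((k : ℝ) + 1) ^ 2 := by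
    rw [← Real.norm_eq_abs]
    exact tsum_of_norm_bounded ((Summable.hasSum ha).mul_left 16)
      fun n => abs_mul_legendreP_le hx _ n
  have h2 : |∑' n, b n * chebyshevU n x| ≤ ∑' k : ℕ, |b k| * ((k : ℝ) + 1) ^ 2 := by
    rw [← Real.norm_eq_abs]
    exact tsum_of_norm_bounded (Summable.hasSum hb) fun n => abs_mul_chebyshevU_le hx _ n
  refine (abs_add_le _ _).trans (add_le_add h1 ?_)
  rw [abs_mul, abs_of_nonneg (Real.sqrt_nonneg _)]
  exact mul_le_mul (sqrt_one_add_le hx) h2 (abs_nonneg _) (by norm_num)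

lemma rhs_sub {a' b' : ℕ → ℝ} (ha : QuadSummable a) (hb : QuadSummable b) (ha' : QuadSummable a')
    (hb' : QuadSummable b') {x : ℝ} (hx : x ∈ Set.Icc (-1 : ℝ) 1) :
    rhs (a - a') (b - b') x = rhs a b x - rhs a' b' x := by
  simp only [rhs, Pi.sub_apply, sub_mul]
  rw [(ha.summable_legendreP hx).tsum_sub (ha'.summable_legendreP hx),
    (hb.summable_chebyshevU hx).tsum_sub (hb'.summable_chebyshevU hx)]
  ring

lemma uN_eq_rhs (σ : ℝ) (e f : ℕ → ℝ) (N : ℕ) :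
    uN σ e f N = rhs (aN σ e f N) (bN σ e f N) := by
  funext x
  rw [uN, rhs, tsum_eq_sum (s := Finset.range N), tsum_eq_sum (s := Finset.range N)]
  · intro n hn
    rw [bN_eq_extend, extend_of_le _ (by simpa using hn), zero_mul]
  · intro n hn
    rw [aN_eq_extend, extend_of_le _ (by simpa using hn), zero_mul]

lemma eLpNorm_volI_le {g : ℝ → ℝ} {C : ℝ} (hg : ∀ x ∈ Set.Icc (-1 : ℝ) 1, |g x| ≤ C) :
    eLpNorm g 2 volI ≤ ENNReal.ofReal (2 * C) := by
  have h1 : ∀ᵐ x ∂volI, ‖g x‖ ≤ C := by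
    filter_upwards [ae_restrict_mem (μ := volume) (s := Set.Icc (-1 : ℝ) 1) measurableSet_Icc]
      with x hx using hg x hx
  refine (eLpNorm_le_of_ae_bound h1).trans ?_
  rw [ENNReal.ofReal_mul (by norm_num)]
  refine mul_le_mul_left ?_ _
  have h2 : volI Set.univ = 2 := by
    rw [volI, Measure.restrict_apply_univ, Real.volume_Icc]
    norm_num
  rw [h2]
  calc (2 : ENNReal) ^ (ENNReal.toReal 2)⁻¹ ≤ 2 ^ (1 : ℝ) :=
        ENNReal.rpow_le_rpow_of_exponent_le (by norm_num) (by norm_num)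
    _ = ENNReal.ofReal 2 := by simp

theorem eLpNorm_uN_sub_le (hw : IsWeight w B) (hW : IsWeight W B') (hwW : ∀ k, w k ≤ W k)
    (hS : Summable fun k : ℕ => ((k : ℝ) + 1) ^ 2 / w k) {ε : ℕ → ℝ}
    (hε : ∀ᶠ N in atTop, 0 ≤ ε N ∧ ∀ k, N ≤ k → w k ≤ ε N * W k) {σ : ℝ} (hσ : σ ≠ 0)
    {e f : ℕ → ℝ} (he : MemW W e) (hf : MemW W f) (ha : QuadSummable a) (hb : QuadSummable b)
    (h : SolvesSystem σ e f a b) :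
    ∃ C, ∀ᶠ N in atTop, eLpNorm (uN σ e f N - rhs a b) 2 volI ≤ ENNReal.ofReal (C * ε N) := by
  obtain ⟨a', b', ha', hb', h'⟩ := hW.exists_solvesSystem hσ he hf
  obtain ⟨m, hm⟩ := hW.polyGrowth
  obtain ⟨rfl, rfl⟩ := h.eq_of_polyGrowth hσ h' (ha.polyGrowth.mono (le_max_left 0 m))
    ((hm _ ha').mono (le_max_right 0 m))
  obtain ⟨C, hC0, hC⟩ := hw.finSection_error hσ
  set S := ∑' k : ℕ, ((k : ℝ) + 1) ^ 2 / w k with hSdef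
  have hS0 : 0 ≤ S := tsum_nonneg fun k => div_nonneg (by positivity) (hw.pos k).le
  set M := wnorm W a' + wnorm W b' with hM
  have haw := ha'.mono hw.pos hwW
  have hbw := hb'.mono hw.pos hwW
  refine ⟨2 * (18 * (C * M * S)), ?_⟩
  filter_upwards [hC, hε] with N hN hεN
  obtain ⟨h1, h2⟩ := hN e f a' b' haw hbw h'
  have h3 : C * (wnorm w (tail N a') + wnorm w (tail N b')) ≤ C * M * ε N := by
    have := add_le_add (wnorm_tail_le hw.pos ha' hεN.1 hεN.2) (wnorm_tail_le hw.pos hb' hεN.1 hεN.2)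
    have := mul_le_mul_of_nonneg_left this hC0
    rw [hM]
    linarith
  have haN : MemW w (aN σ e f N) := memW_of_eq_zero fun k hk => by
    rw [aN_eq_extend, extend_of_le _ hk]
  have hbN : MemW w (bN σ e f N) := memW_of_eq_zero fun k hk => by
    rw [bN_eq_extend, extend_of_le _ hk]
  have hda := haN.sub haw
  have hdb := hbN.sub hbw
  rw [show 2 * (18 * (C * M * S)) * ε N = 2 * (18 * (C * M * ε N * S)) by ring]
  refine eLpNorm_volI_le fun x hx => ?_
  rw [Pi.sub_apply, uN_eq_rhs, ← rhs_sub (haN.quadSummable hw.pos hS) (hbN.quadSummable hw.pos hS)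
    ha hb hx]
  refine (abs_rhs_le (hda.quadSummable hw.pos hS) (hdb.quadSummable hw.pos hS) hx).trans ?_
  have h4 := (hda.tsum_abs_mul_sq_le hw.pos hS).trans
    (mul_le_mul_of_nonneg_right (h1.trans h3) hS0)
  have h5 := (hdb.tsum_abs_mul_sq_le hw.pos hS).trans
    (mul_le_mul_of_nonneg_right (h2.trans h3) hS0)
  linarith

theorem tendsto_wnorm_finSection (hw : IsWeight w B) {σ : ℝ} (hσ : σ ≠ 0) {e f : ℕ → ℝ}
    (ha : MemW w a) (hb : MemW w b) (h : SolvesSystem σ e f a b) :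
    Tendsto (fun N => wnorm w (aN σ e f N - a)) atTop (𝓝 0) ∧
    Tendsto (fun N => wnorm w (bN σ e f N - b)) atTop (𝓝 0) := by
  obtain ⟨C, -, hC⟩ := hw.finSection_error hσ
  have hlim := ((tendsto_wnorm_tail ha).add (tendsto_wnorm_tail hb)).const_mul C
  rw [add_zero, mul_zero] at hlim
  constructor
  · refine tendsto_of_tendsto_of_tendsto_of_le_of_le' tendsto_const_nhds hlim
      (Eventually.of_forall fun N => wnorm_nonneg _ _) ?_
    filter_upwards [hC] with N hN using (hN e f a b ha hb h).1
  · refine tendsto_of_tendsto_of_tendsto_of_le_of_le' tendsto_const_nhds hlim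
      (Eventually.of_forall fun N => wnorm_nonneg _ _) ?_
    filter_upwards [hC] with N hN using (hN e f a b ha hb h).2

lemma summable_sq_div_rpow :
    Summable fun k : ℕ => ((k : ℝ) + 1) ^ 2 / ((k : ℝ) + 1) ^ (4 : ℝ) := by
  have := (summable_nat_add_iff 1).2 (Real.summable_nat_rpow.2 (show (-2 : ℝ) < -1 by norm_num))
  refine this.congr fun k => ?_
  have h1 : (0 : ℝ) < (k : ℝ) + 1 := by positivity
  rw [← Real.rpow_natCast, ← Real.rpow_sub h1]
  push_cast
  norm_num

lemma summable_sq_div_pow {c : ℝ} (hc : 1 < c) :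
    Summable fun k : ℕ => ((k : ℝ) + 1) ^ 2 / c ^ k := by
  have hc0 : 0 < c := by linarith
  have h1 : ‖c⁻¹‖ < 1 := by
    rw [Real.norm_eq_abs, abs_of_pos (by positivity)]
    exact inv_lt_one_of_one_lt₀ hc
  have h2 := (summable_nat_add_iff 1).2 (summable_pow_mul_geometric_of_norm_lt_one (R := ℝ) 2 h1)
  refine (h2.mul_left c).congr fun k => ?_
  push_cast
  rw [pow_succ, inv_pow]
  field_simp
  ring

lemma memW_pow_of_abs_le {ρ c K : ℝ} {v : ℕ → ℝ} (hρ : 0 < ρ) (hc : 0 < c) (hcρ : c * ρ < 1)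
    (hv : ∀ k, |v k| ≤ K * ρ ^ k) : MemW (fun k => c ^ k) v := by
  have hs : Summable fun k : ℕ => K ^ 2 * ((c * ρ) ^ 2) ^ k :=
    (summable_geometric_of_lt_one (by positivity)
      (pow_lt_one₀ (by positivity) hcρ two_ne_zero)).mul_left _
  refine memW_iff.2 (Summable.of_nonneg_of_le (fun _ => sq_nonneg _) (fun k => ?_) hs)
  have h1 : |c ^ k * v k| ≤ K * (c * ρ) ^ k := by
    rw [abs_mul, abs_of_pos (by positivity), mul_pow]
    calc c ^ k * |v k| ≤ c ^ k * (K * ρ ^ k) := mul_le_mul_of_nonneg_left (hv k) (by positivity)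
      _ = _ := by ring
  have h2 := pow_le_pow_left₀ (abs_nonneg _) h1 2
  rw [sq_abs] at h2
  refine h2.trans (le_of_eq ?_)
  rw [mul_pow, ← pow_mul, ← pow_mul, mul_comm k]

theorem exists_isL2Solution {σ : ℝ} (hσ : σ ≠ 0) {e f : ℕ → ℝ} (ha : QuadSummable a)
    (hb : QuadSummable b) (h : SolvesSystem σ e f a b) :
    IsL2Solution σ e f (rhs a b) ∧ ∀ v, IsL2Solution σ e f v → v =ᵐ[volI] rhs a b :=
  ⟨isL2Solution_rhs ha hb h, fun _ hv => ae_eq_of_isL2Solution hσ (isL2Solution_rhs ha hb h) hv⟩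

end

end HalfIntegral

end

theorem corollaryB4 (σ : ℝ) (hσ : σ ≠ 0) (e f : ℕ → ℝ) :
    -- the finite sections are invertible from some size on
    (∀ᶠ N : ℕ in atTop, IsUnit (HalfIntegral.blockSection σ N)) ∧
    -- convergence in the weighted sequence space
    (∀ lam : ℝ, HalfIntegral.MemEll lam e → HalfIntegral.MemEll lam f →
      ∃ a b : ℕ → ℝ,
        HalfIntegral.MemEll lam a ∧ HalfIntegral.MemEll lam b ∧
        HalfIntegral.SolvesSystem σ e f a b ∧
        (∀ a' b' : ℕ → ℝ, HalfIntegral.MemEll lam a' → HalfIntegral.MemEll lam b' →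
          HalfIntegral.SolvesSystem σ e f a' b' → a' = a ∧ b' = b) ∧
        Tendsto (fun N => HalfIntegral.ellNorm lam (HalfIntegral.aN σ e f N - a)) atTop (𝓝 0) ∧
        Tendsto (fun N => HalfIntegral.ellNorm lam (HalfIntegral.bN σ e f N - b)) atTop (𝓝 0)) ∧
    -- spectrally fast convergence
    ((∀ lam : ℝ, HalfIntegral.MemEll lam e ∧ HalfIntegral.MemEll lam f) →
      ∃ u : ℝ → ℝ, HalfIntegral.IsL2Solution σ e f u ∧
        (∀ v : ℝ → ℝ, HalfIntegral.IsL2Solution σ e f v → v =ᵐ[HalfIntegral.volI] u) ∧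
        ∀ p : ℝ, 0 < p → ∃ C : ℝ, ∀ᶠ N : ℕ in atTop,
          eLpNorm (HalfIntegral.uN σ e f N - u) 2 HalfIntegral.volI
            ≤ ENNReal.ofReal (C * (N : ℝ) ^ (-p))) ∧
    -- exponentially fast convergence
    (∀ ρ : ℝ, 0 < ρ → ρ < 1 →
      (∃ K : ℝ, ∀ k : ℕ, |e k| ≤ K * ρ ^ k ∧ |f k| ≤ K * ρ ^ k) →
      ∃ u : ℝ → ℝ, HalfIntegral.IsL2Solution σ e f u ∧
        (∀ v : ℝ → ℝ, HalfIntegral.IsL2Solution σ e f v → v =ᵐ[HalfIntegral.volI] u) ∧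
        ∀ r : ℝ, ρ < r → r < 1 → ∃ C : ℝ, ∀ᶠ N : ℕ in atTop,
          eLpNorm (HalfIntegral.uN σ e f N - u) 2 HalfIntegral.volI
            ≤ ENNReal.ofReal (C * r ^ N)) := by
  refine ⟨HalfIntegral.eventually_isUnit_blockSection hσ, ?_, ?_, ?_⟩
  · intro lam he hf
    have hw := HalfIntegral.isWeight_rpow lam
    obtain ⟨a, b, ha, hb, hab⟩ := hw.exists_solvesSystem hσ
      (HalfIntegral.memEll_iff.1 he) (HalfIntegral.memEll_iff.1 hf)
    obtain ⟨m, hm⟩ := hw.polyGrowth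
    have hlim := HalfIntegral.tendsto_wnorm_finSection hw hσ ha hb hab
    simp only [HalfIntegral.ellNorm_eq]
    exact ⟨a, b, HalfIntegral.memEll_iff.2 ha, HalfIntegral.memEll_iff.2 hb, hab,
      fun a' b' ha' _ hab' => hab.eq_of_polyGrowth hσ hab' (hm _ ha)
        (hm _ (HalfIntegral.memEll_iff.1 ha')), hlim.1, hlim.2⟩
  · intro hef
    have hw := HalfIntegral.isWeight_rpow 4
    obtain ⟨a, b, ha, hb, hab⟩ := hw.exists_solvesSystem hσ
      (HalfIntegral.memEll_iff.1 (hef 4).1) (HalfIntegral.memEll_iff.1 (hef 4).2)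
    have hqa := ha.quadSummable hw.pos HalfIntegral.summable_sq_div_rpow
    have hqb := hb.quadSummable hw.pos HalfIntegral.summable_sq_div_rpow
    obtain ⟨h1, h2⟩ := HalfIntegral.exists_isL2Solution hσ hqa hqb hab
    refine ⟨_, h1, h2, fun p hp => ?_⟩
    refine HalfIntegral.eLpNorm_uN_sub_le hw (HalfIntegral.isWeight_rpow (4 + p)) (fun k => ?_)
      HalfIntegral.summable_sq_div_rpow (ε := fun N : ℕ => (N : ℝ) ^ (-p)) ?_ hσ
      (HalfIntegral.memEll_iff.1 (hef _).1) (HalfIntegral.memEll_iff.1 (hef _).2) hqa hqb hab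
    · refine Real.rpow_le_rpow_of_exponent_le ?_ (by linarith)
      linarith [(Nat.cast_nonneg k : (0 : ℝ) ≤ k)]
    · filter_upwards [eventually_ge_atTop 1] with N hN
      refine ⟨by positivity, fun k hk => ?_⟩
      have hk1 : (0 : ℝ) < (k : ℝ) + 1 := by positivity
      have hN0 : (0 : ℝ) < N := by exact_mod_cast hN
      have hNk : (N : ℝ) ≤ k := by exact_mod_cast hk
      rw [Real.rpow_add hk1, Real.rpow_neg hN0.le, mul_left_comm]
      refine le_mul_of_one_le_right (by positivity) ?_
      rw [inv_mul_eq_div, one_le_div (by positivity)]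
      exact Real.rpow_le_rpow hN0.le (by linarith) hp.le
  · rintro ρ hρ0 hρ1 ⟨K, hK⟩
    have key : ∀ r : ℝ, ρ < r → r < 1 → HalfIntegral.MemW (fun k => (1 / r) ^ k) e ∧
        HalfIntegral.MemW (fun k => (1 / r) ^ k) f := fun r hr _ => by
      have hr0 : 0 < r := hρ0.trans hr
      have h1 : 1 / r * ρ < 1 := by
        rw [one_div_mul_eq_div, div_lt_one hr0]
        exact hr
      exact ⟨HalfIntegral.memW_pow_of_abs_le hρ0 (by positivity) h1 fun k => (hK k).1,
        HalfIntegral.memW_pow_of_abs_le hρ0 (by positivity) h1 fun k => (hK k).2⟩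
    obtain ⟨r₀, hr₀, hr₀1⟩ := exists_between hρ1
    have hr₀0 : 0 < r₀ := hρ0.trans hr₀
    have hc₀ : 1 < 1 / r₀ := (one_lt_div hr₀0).2 hr₀1
    have hw := HalfIntegral.isWeight_pow hc₀.le
    obtain ⟨a, b, ha, hb, hab⟩ := hw.exists_solvesSystem hσ (key r₀ hr₀ hr₀1).1 (key r₀ hr₀ hr₀1).2
    have hqa := ha.quadSummable hw.pos (HalfIntegral.summable_sq_div_pow hc₀)
    have hqb := hb.quadSummable hw.pos (HalfIntegral.summable_sq_div_pow hc₀)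
    obtain ⟨h1, h2⟩ := HalfIntegral.exists_isL2Solution hσ hqa hqb hab
    refine ⟨_, h1, h2, fun r hr hr1 => ?_⟩
    obtain ⟨s, hs, hsr⟩ := exists_between hr
    have hs0 : 0 < s := hρ0.trans hs
    have hr0 : 0 < r := hρ0.trans hr
    have hc : 1 < r / s := (one_lt_div hs0).2 hsr
    have hc' : 1 ≤ 1 / s := (one_le_div hs0).2 (hsr.trans hr1).le
    refine HalfIntegral.eLpNorm_uN_sub_le (HalfIntegral.isWeight_pow hc.le)
      (HalfIntegral.isWeight_pow hc') (fun k => ?_) (HalfIntegral.summable_sq_div_pow hc)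
      (ε := fun N : ℕ => r ^ N) (Eventually.of_forall fun N => ⟨by positivity, fun k hk => ?_⟩) hσ
      (key s hs (hsr.trans hr1)).1 (key s hs (hsr.trans hr1)).2 hqa hqb hab
    · exact pow_le_pow_left₀ (by positivity) (div_le_div_of_nonneg_right hr1.le hs0.le) k
    · rw [div_eq_mul_one_div, mul_pow]
      exact mul_le_mul_of_nonneg_right (pow_le_pow_of_le_one hr0.le hr1.le hk) (by positivity)
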